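/- Let claims arrive at times $0=T_0<T_1<T_2<\cdots$ (only finitely many in bounded time; $T_i=\infty$ is allowed when there are fewer than $i$ claims), let $V_i=T_i-T_{i-1}$ be the inter-claim times (with $V_i=\infty$ if $T_i=\infty$), let $N(t)=\#\{i\ge 1: T_i\le t\}$, let the real random variables $X_1,X_2,\dots$ be the claim sizes, and let $S(t)=\sum_{i=1}^{N(t)}X_i$ be the aggregate claim. Assume that $N$ is a mixed Poisson process with structure distribution $L$ on $[0,\infty)$, i.e. $N(0)=0$ a.s. and the joint law of the increments of $N$ is the $L(d\lambda)$-mixture of the laws of the increments of homogeneous Poisson processes of rate $\lambda$. Assume that 1. each $X_i$ depends on the claim arrival process only via $V_i$, i.e. the conditional distribution of $X_i$ given $(T_j)_{j\ge 0}$ equals its conditional distribution given $V_i$; 2. $X_1,X_2,\dots$ are conditionally independent given the claim arrival process; 3. the conditional claims $X_i\mid V_i=v$ have finite second moments and the same first and second moments: for every $i$ and almost every finite $v$ (with respect to the law of $V_i$), $\mathbf{E}[X_i^2\mid V_i=v]<\infty$, $\mathbf{E}[X_i\mid V_i=v]=\Delta_1(v)$ and $\mathbf{E}[X_i^2\mid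 V_i=v]=\Theta_1(v)$, where $\Delta_1(v)=\mathbf{E}[X_1\mid V_1=v]$ and $\Theta_1(v)=\mathbf{E}[X_1^2\mid V_1=v]$. Then for every $t\ge 0$ $$\mathbf{E}[S^2(t)]=\int_0^\infty\!\int_0^t \lambda e^{-\lambda v}\,\Theta_1(v)\,\bigl(\lambda(t-v)+1\bigr)\,dv\,dL(\lambda) +\int_0^\infty\!\int_0^t\!\int_0^{t-y}\lambda^2e^{-\lambda(y+v)}\,\Delta_1(y)\,\Delta_1(v)\,\Bigl(\bigl(\lambda(t-y-v)+2\bigr)^2-2\Bigr)\,dv\,dy\,dL(\lambda)$$ in the following sense. (a) If all $X_i\ge 0$ almost surely, the identity holds in $[0,\infty]$. (b) For real-valued $X_i$, if both integrals on the right-hand side converge absolutely, then $\mathbf{E}[S^2(t)]<\infty$ and the identity holds. -/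

import Mathlib

open MeasureTheory ProbabilityTheory Set
open scoped NNReal ENNReal

noncomputable section

namespace AggregateClaims

variable {Ω : Type*} [MeasurableSpace Ω]

/-- Claim arrival times `T 0 = 0 < T 1 < T 2 < ⋯`, where `T (i + 1) = ∞` means that there are at
most `i` claims altogether, and where only finitely many claims arrive in bounded time. -/
structure IsClaimArrivalSequence (P : Measure Ω) (T : ℕ → Ω → ℝ≥0∞) : Prop where
  measurable : ∀ i, Measurable (T i)
  zero : ∀ᵐ ω ∂P, T 0 ω = 0
  lt_succ : ∀ᵐ ω ∂P, ∀ i, T i ω ≠ ∞ → T i ω < T (i + 1) ω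
  succ_eq_top : ∀ᵐ ω ∂P, ∀ i, T i ω = ∞ → T (i + 1) ω = ∞
  finite : ∀ᵐ ω ∂P, ∀ t : ℝ≥0, {i : ℕ | T (i + 1) ω ≤ t}.Finite

/-- The number `N(t)` of claims that arrive up to and including time `t`. -/
def claimNumber (T : ℕ → Ω → ℝ≥0∞) (t : ℝ≥0) (ω : Ω) : ℕ :=
  {i : ℕ | T (i + 1) ω ≤ t}.ncard

/-- The time `T (i + 1) - T i` between successive claims, which is `∞` if `T (i + 1) = ∞`. -/
def interClaimTime (T : ℕ → Ω → ℝ≥0∞) (i : ℕ) (ω : Ω) : ℝ≥0∞ :=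
  if T (i + 1) ω = ∞ then ∞ else T (i + 1) ω - T i ω

/-- The aggregate claim `S(t)`, the sum of the first `N(t)` claims. Claims are counted from `0`:
`X i` is the size of the claim that arrives at `T (i + 1)`, after the time `interClaimTime T i`. -/
def aggregateClaim (T : ℕ → Ω → ℝ≥0∞) (X : ℕ → Ω → ℝ) (t : ℝ≥0) (ω : Ω) : ℝ :=
  ∑ i ∈ Finset.range (claimNumber T t ω), X i ω

/-- `N` is a mixed Poisson process with structure distribution `L`: it starts at `0`, and the joint
law of its increments is the `L`-mixture over `r` of those of a Poisson process of rate `r`. -/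
structure IsMixedPoissonProcess (P : Measure Ω) (N : ℝ≥0 → Ω → ℕ) (L : Measure ℝ≥0) : Prop where
  zero : ∀ᵐ ω ∂P, N 0 ω = 0
  increments : ∀ (k : ℕ) (s : Fin (k + 1) → ℝ≥0), Monotone s → ∀ n : Fin k → ℕ,
    P {ω | ∀ j : Fin k, N (s j.succ) ω = N (s j.castSucc) ω + n j} =
      ∫⁻ r, ∏ j : Fin k, poissonMeasure (r * (s j.succ - s j.castSucc)) {n j} ∂L

/-- The sigma-algebra generated by the claim arrival process. -/
abbrev arrivalSigma (T : ℕ → Ω → ℝ≥0∞) : MeasurableSpace Ω :=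
  MeasurableSpace.comap (fun ω i => T i ω) MeasurableSpace.pi

/-- Each `X i` depends on the claim arrival process only via `interClaimTime T i`: the conditional
distribution of `X i` given the whole arrival process is the one given `interClaimTime T i`. -/
def DependOnlyOnInterClaimTimes (P : Measure Ω) (T : ℕ → Ω → ℝ≥0∞) (X : ℕ → Ω → ℝ) : Prop :=
  ∀ (i : ℕ) (A : Set ℝ), MeasurableSet A →
    P⟦X i ⁻¹' A | arrivalSigma T⟧ =ᵐ[P]
      P⟦X i ⁻¹' A | MeasurableSpace.comap (interClaimTime T i) inferInstance⟧

/-- The claims are conditionally independent given the claim arrival process. -/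
def CondIndepGivenArrivals (P : Measure Ω) (T : ℕ → Ω → ℝ≥0∞) (X : ℕ → Ω → ℝ) : Prop :=
  ∀ (s : Finset ℕ) (A : ℕ → Set ℝ), (∀ i ∈ s, MeasurableSet (A i)) →
    P⟦⋂ i ∈ s, X i ⁻¹' A i | arrivalSigma T⟧ =ᵐ[P]
      ∏ i ∈ s, P⟦X i ⁻¹' A i | arrivalSigma T⟧

/-- The conditional moment `E[Y ^ k | V = v]`, as a function of `v`. -/
def condMoment (P : Measure Ω) [IsFiniteMeasure P] (k : ℕ) (Y : Ω → ℝ) (V : Ω → ℝ≥0∞)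
    (v : ℝ≥0∞) : ℝ :=
  ∫ x, x ^ k ∂(condDistrib Y V P v)

/-- Finite second moments, and the same first and second moments, of the conditional claims
`X i` given `interClaimTime T i = v`, for almost every finite `v`. -/
def SameCondMoments (P : Measure Ω) [IsFiniteMeasure P] (T : ℕ → Ω → ℝ≥0∞)
    (X : ℕ → Ω → ℝ) : Prop :=
  ∀ i : ℕ, ∀ᵐ v ∂(P.map (interClaimTime T i)), v ≠ ∞ →
    Integrable (fun x : ℝ => x ^ 2) (condDistrib (X i) (interClaimTime T i) P v) ∧
    condMoment P 1 (X i) (interClaimTime T i) v = condMoment P 1 (X 0) (interClaimTime T 0) v ∧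
    condMoment P 2 (X i) (interClaimTime T i) v = condMoment P 2 (X 0) (interClaimTime T 0) v

/-- `r e^{-r v} Θ(v) (r (t - v) + 1)`. -/
def singleIntegrand (Θ : ℝ≥0∞ → ℝ) (t r v : ℝ) : ℝ :=
  r * Real.exp (-(r * v)) * Θ (ENNReal.ofReal v) * (r * (t - v) + 1)

/-- `r ^ 2 e^{-r (y + v)} Δ(y) Δ(v) ((r (t - y - v) + 2) ^ 2 - 2)`. -/
def pairIntegrand (Δ : ℝ≥0∞ → ℝ) (t r y v : ℝ) : ℝ :=
  r ^ 2 * Real.exp (-(r * (y + v))) * Δ (ENNReal.ofReal y) * Δ (ENNReal.ofReal v) *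
    ((r * (t - y - v) + 2) ^ 2 - 2)

end AggregateClaims

end

noncomputable section

namespace AggregateClaims

/-! ### The claim number of an arrival sequence -/

/-! Expand `S(t)^2` into the diagonal sum of `X i ^ 2` and twice the sum of `X i * X j` over `i <
j`, both over claims arriving by time `t`. Given the arrival times, the claims are independent and
`X i` sees only its own waiting time `V i`, so the terms average to `Θ (V i)` and `2 * Δ (V i) * Δ
(V j)` (`map_arrivalPath_claims` and its corollaries). What is left is to compute expected sums of
functions of one waiting time, or of two, for a mixed Poisson process.

These are Campbell formulas. At rate `r`, the renewal epochs, with the one at `0` included, have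
intensity `δ₀ + r dz`, and each is followed by an independent exponential wait of density `r
e^{-rv}`. So the laws of `(T i, T (i + 1))`, summed over `i`, form the measure `(δ₀ + r dz) r
e^{-rv} dv` mixed over `r`; for `i < j` the four times `(T i, T (i + 1), T j, T (j + 1))` give two
such factors, the second started at the end of the first. Integrating out the epoch leaves the
weight `r (t - v) + 1`, and integrating out both epochs leaves `((r (t - y - v) + 2) ^ 2 - 2) / 2`,
whose denominator cancels the factor `2` of the off-diagonal terms.

The hypothesis on `N` concerns increments only, so these intensities are identified without deriving
the law of the waiting times (`sum_map_consecutive`, `sum_map_quadruple`). For `a ≤ q ≤ b`, some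
consecutive pair has `T i ≤ a` and `q < T (i + 1) ≤ b` exactly when `N` is constant on `[a, q]` and
grows on `(q, b]`, and then `i = N(a)` is unique. The box thus has an increment probability as its
mass, and such boxes determine a measure carried by ordered tuples.

For nonnegative claims every step is an identity in `[0, ∞]`. For signed claims, absolute
convergence of the right-hand side bounds `|Δ Δ|` but not the conditional mean of `|X i X j|`, so
termwise domination of the double sum is unavailable. Instead the identity is proved on each event
`{N(t) = n}`, where finitely many square-integrable claims occur. Since `S(t)^2 ≥ 0` and its
conditional mean is integrable, the pieces add up (`integrable_of_setIntegral_eq`). -/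

lemma lt_ncard_iff_of_isLowerSet {s : Set ℕ} (hs : s.Finite) (hl : IsLowerSet s) (i : ℕ) :
    i < s.ncard ↔ i ∈ s := by
  constructor
  · intro h
    by_contra hi
    have hsub : s ⊆ Set.Iio i := fun j hj => by
      by_contra hij
      exact hi (hl (not_lt.1 hij) hj)
    have h2 := Set.ncard_le_ncard hsub (Set.finite_Iio i)
    rw [Set.ncard_eq_toFinset_card' (Set.Iio i)] at h2
    simp at h2
    omega
  · intro h
    have hsub : Set.Iic i ⊆ s := fun j hj => hl hj h
    have h2 := Set.ncard_le_ncard hsub hs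
    rw [Set.ncard_eq_toFinset_card' (Set.Iic i)] at h2
    simp at h2
    omega

variable {Ω : Type*} [MeasurableSpace Ω] {P : Measure Ω} {T : ℕ → Ω → ℝ≥0∞}

lemma IsClaimArrivalSequence.ae_monotone (hT : IsClaimArrivalSequence P T) :
    ∀ᵐ ω ∂P, Monotone fun i => T i ω := by
  filter_upwards [hT.lt_succ, hT.succ_eq_top] with ω h1 h2
  refine monotone_nat_of_le_succ fun i => ?_
  by_cases h : T i ω = ∞
  · rw [h2 i h, h]
  · exact (h1 i h).le

/-- The dictionary between arrival times and claim numbers, on one null set for all `a` and `i`. It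
turns every later event about `T` into arithmetic in `N`. Off this null set `ncard` could meet an
infinite set and return `0`. -/
lemma IsClaimArrivalSequence.ae_le_iff (hT : IsClaimArrivalSequence P T) :
    ∀ᵐ ω ∂P, ∀ (a : ℝ≥0) (i : ℕ), T i ω ≤ a ↔ i ≤ claimNumber T a ω := by
  filter_upwards [hT.ae_monotone, hT.zero, hT.finite] with ω hm h0 hf a i
  cases i with
  | zero => simp [h0]
  | succ i =>
    rw [Nat.succ_le_iff, claimNumber, lt_ncard_iff_of_isLowerSet (hf a)]
    · rfl
    · intro j k hkj hj
      exact (hm (Nat.succ_le_succ hkj)).trans hj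

lemma IsClaimArrivalSequence.ae_lt_succ_of_ne_top (hT : IsClaimArrivalSequence P T) :
    ∀ᵐ ω ∂P, ∀ i, T (i + 1) ω ≠ ∞ → T i ω < T (i + 1) ω := by
  filter_upwards [hT.lt_succ, hT.succ_eq_top] with ω h1 h2 i hi
  exact h1 i fun h => hi (h2 i h)

lemma IsClaimArrivalSequence.aemeasurable_claimNumber (hT : IsClaimArrivalSequence P T)
    (a : ℝ≥0) : AEMeasurable (claimNumber T a) P := by
  refine NullMeasurable.aemeasurable (fun s _ => ?_)
  have : claimNumber T a ⁻¹' s = ⋃ n ∈ s, claimNumber T a ⁻¹' {n} := by ext; simp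
  rw [this]
  refine NullMeasurableSet.biUnion s.to_countable fun n _ => ?_
  have hm : MeasurableSet {ω | T n ω ≤ a ∧ ¬ T (n + 1) ω ≤ a} :=
    (measurableSet_le (hT.measurable n) measurable_const).inter
      (measurableSet_le (hT.measurable (n + 1)) measurable_const).compl
  refine hm.nullMeasurableSet.congr ?_
  filter_upwards [hT.ae_le_iff] with ω h
  refine propext ?_
  change (T n ω ≤ a ∧ ¬ T (n + 1) ω ≤ a) ↔ claimNumber T a ω = n
  rw [h, h]
  omega

lemma IsClaimArrivalSequence.ae_claimNumber_mono (hT : IsClaimArrivalSequence P T) :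
    ∀ᵐ ω ∂P, ∀ a b : ℝ≥0, a ≤ b → claimNumber T a ω ≤ claimNumber T b ω := by
  filter_upwards [hT.ae_le_iff] with ω h a b hab
  rw [← h]
  exact ((h a _).2 le_rfl).trans (by exact_mod_cast hab)

/-! ### Increments of a mixed Poisson process -/

variable {L : Measure ℝ≥0}

lemma measurable_poissonMeasure_mul_singleton (c : ℝ≥0) (n : ℕ) :
    Measurable fun r : ℝ≥0 => poissonMeasure (r * c) {n} := by
  simp_rw [poissonMeasure_singleton]
  fun_prop

/-- Countable additivity over the possible increment vectors. Sets in place of single values are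
needed because the gap events ask for "at least one claim" and for an unconstrained increment. -/
lemma IsMixedPoissonProcess.measure_increments_mem {N : ℝ≥0 → Ω → ℕ}
    (hN : IsMixedPoissonProcess P N L) (hm : ∀ a, AEMeasurable (N a) P) {k : ℕ}
    {s : Fin (k + 1) → ℝ≥0} (hs : Monotone s) (A : Fin k → Set ℕ) :
    P {ω | ∀ j : Fin k, ∃ n ∈ A j, N (s j.succ) ω = N (s j.castSucc) ω + n} =
      ∫⁻ r, ∏ j : Fin k, poissonMeasure (r * (s j.succ - s j.castSucc)) (A j) ∂L := by
  have h1 : {ω | ∀ j : Fin k, ∃ n ∈ A j, N (s j.succ) ω = N (s j.castSucc) ω + n} =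
      ⋃ n : Set.pi univ A, {ω | ∀ j, N (s j.succ) ω = N (s j.castSucc) ω + n.1 j} := by
    ext ω
    simp only [mem_ofPred_eq, mem_iUnion, Subtype.exists, mem_pi, mem_univ, forall_const]
    constructor
    · intro h
      choose n hn hn' using h
      exact ⟨n, hn, hn'⟩
    · rintro ⟨n, hn, hn'⟩ j
      exact ⟨n j, hn j, hn' j⟩
  rw [h1, measure_iUnion₀]
  · simp_rw [hN.increments k s hs]
    rw [← lintegral_tsum]
    · refine lintegral_congr fun r => ?_
      -- The product of the Poisson masses is the mass of the box `∏ A j` under the product measure,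
      -- and that box is a countable union of points.
      rw [← Measure.pi_pi]
      have h2 : Set.pi univ A = ⋃ n : Set.pi univ A, {n.1} := by ext; simp
      conv_rhs => rw [h2]
      rw [measure_iUnion]
      · refine tsum_congr fun n => ?_
        rw [← Set.univ_pi_singleton, Measure.pi_pi]
      · intro m n hmn
        simpa [Function.onFun, Subtype.ext_iff] using fun h => hmn (Subtype.ext h)
      · exact fun n => measurableSet_singleton _
    · intro n
      exact (Finset.measurable_prod _ fun j _ =>
        measurable_poissonMeasure_mul_singleton _ _).aemeasurable
  · intro m n hmn
    refine (Set.disjoint_left.2 fun ω hω hω' => hmn ?_).aedisjoint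
    ext j
    have := hω j
    have := hω' j
    omega
  · intro n
    have : {ω | ∀ j, N (s j.succ) ω = N (s j.castSucc) ω + n.1 j} =
        ⋂ j, (fun ω => (N (s j.succ) ω, N (s j.castSucc) ω)) ⁻¹' {p | p.1 = p.2 + n.1 j} := by
      ext; simp
    rw [this]
    exact NullMeasurableSet.iInter fun j =>
      ((hm _).prodMk (hm _)).nullMeasurable (MeasurableSet.of_discrete)

/-- Probability that a Poisson process of rate `r` has no point in `(a, q]` and some point in
`(q, b]`. -/
def gapProb (a q b r : ℝ≥0) : ℝ≥0∞ :=
  ENNReal.ofReal (Real.exp (-(r * (q - a))) - Real.exp (-(r * (b - a))))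

/-- Both sides are `e^{-r(q-a)} (1 - e^{-r(b-q)})`. -/
lemma poissonMeasure_gap {a q b : ℝ≥0} (haq : a ≤ q) (hqb : q ≤ b) (r : ℝ≥0) :
    poissonMeasure (r * (q - a)) {0} * poissonMeasure (r * (b - q)) (Ici 1) =
      gapProb a q b r := by
  have h0 : (Ici 1 : Set ℕ) = {0}ᶜ := by ext n; simp; omega
  rw [h0, prob_compl_eq_one_sub (measurableSet_singleton _), poissonMeasure_singleton,
    poissonMeasure_singleton]
  simp only [NNReal.coe_mul, pow_zero, mul_one, Nat.factorial_zero, Nat.cast_one, div_one]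
  rw [NNReal.coe_sub haq, NNReal.coe_sub hqb, ← ENNReal.ofReal_one,
    ← ENNReal.ofReal_sub _ (Real.exp_nonneg _), ← ENNReal.ofReal_mul (Real.exp_nonneg _), gapProb,
    mul_sub, ← Real.exp_add]
  ring_nf

lemma monotone_vecCons₃ {a q b : ℝ≥0} (haq : a ≤ q) (hqb : q ≤ b) : Monotone ![a, q, b] := by
  rw [Fin.monotone_iff_le_succ]
  intro i
  fin_cases i <;> simpa

lemma monotone_vecCons₆ {a q b c r d : ℝ≥0} (haq : a ≤ q) (hqb : q ≤ b) (hbc : b ≤ c)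
    (hcr : c ≤ r) (hrd : r ≤ d) : Monotone ![a, q, b, c, r, d] := by
  rw [Fin.monotone_iff_le_succ]
  intro i
  fin_cases i <;> simpa

lemma IsMixedPoissonProcess.measure_gap {N : ℝ≥0 → Ω → ℕ}
    (hN : IsMixedPoissonProcess P N L) (hm : ∀ a, AEMeasurable (N a) P)
    {a q b : ℝ≥0} (haq : a ≤ q) (hqb : q ≤ b) :
    P {ω | N q ω = N a ω ∧ N q ω < N b ω} = ∫⁻ r, gapProb a q b r ∂L := by
  have h := hN.measure_increments_mem hm (monotone_vecCons₃ haq hqb) ![{0}, Ici 1]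
  simp only [Fin.prod_univ_two] at h
  convert h using 1
  · congr 1
    ext ω
    simp only [mem_ofPred_eq, Fin.forall_fin_two]
    simp
    intro _
    constructor
    · intro h
      exact ⟨N b ω - N q ω, by omega, by omega⟩
    · rintro ⟨n, hn, h⟩
      omega
  · refine lintegral_congr fun x => ?_
    rw [← poissonMeasure_gap haq hqb x]
    simp

/-- Five independent increments at fixed rate, the middle one over `(b, c]` being free. Increments
are written by addition in `ℕ`, so even the free one asserts `N b ≤ N c`; this is what `hmono`
supplies. -/
lemma IsMixedPoissonProcess.measure_gap_gap {N : ℝ≥0 → Ω → ℕ}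
    (hN : IsMixedPoissonProcess P N L) (hm : ∀ a, AEMeasurable (N a) P)
    {a q b c r d : ℝ≥0} (haq : a ≤ q) (hqb : q ≤ b) (hbc : b ≤ c) (hcr : c ≤ r) (hrd : r ≤ d)
    (hmono : ∀ᵐ ω ∂P, N b ω ≤ N c ω) :
    P {ω | (N q ω = N a ω ∧ N q ω < N b ω) ∧ N r ω = N c ω ∧ N r ω < N d ω} =
      ∫⁻ x, gapProb a q b x * gapProb c r d x ∂L := by
  have h := hN.measure_increments_mem hm (monotone_vecCons₆ haq hqb hbc hcr hrd)
    ![{0}, Ici 1, univ, {0}, Ici 1]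
  simp only [Fin.prod_univ_five] at h
  convert h using 1
  · refine measure_congr ?_
    filter_upwards [hmono] with ω hω
    refine propext ?_
    change ((N q ω = N a ω ∧ N q ω < N b ω) ∧ N r ω = N c ω ∧ N r ω < N d ω) ↔
      ∀ j : Fin 5, _
    simp only [Fin.forall_fin_succ, Fin.forall_fin_zero]
    simp
    constructor
    · rintro ⟨⟨h1, h2⟩, h3, h4⟩
      exact ⟨h1, ⟨N b ω - N q ω, by omega, by omega⟩, ⟨N c ω - N b ω, by omega⟩, h3,
        ⟨N d ω - N r ω, by omega, by omega⟩⟩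
    · rintro ⟨h1, ⟨n, hn, h2⟩, _, h3, ⟨m, hm, h4⟩⟩
      omega
  · refine lintegral_congr fun x => ?_
    rw [← poissonMeasure_gap haq hqb x, ← poissonMeasure_gap hcr hrd x]
    simp [mul_assoc]

end AggregateClaims

end

noncomputable section

namespace AggregateClaims

/-! ### Measures determined by their values on ordered boxes -/

lemma generateFrom_range_Iic_prod {α β : Type*} [mα : MeasurableSpace α] [mβ : MeasurableSpace β]
    [Preorder α] [Preorder β] [OrderTop α] [OrderTop β]
    (hα : MeasurableSpace.generateFrom (range (Iic : α → Set α)) = mα)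
    (hβ : MeasurableSpace.generateFrom (range (Iic : β → Set β)) = mβ) :
    MeasurableSpace.generateFrom (range (Iic : α × β → Set (α × β))) = Prod.instMeasurableSpace := by
  have h : range (Iic : α × β → Set (α × β)) =
      image2 (· ×ˢ ·) (range (Iic : α → Set α)) (range (Iic : β → Set β)) := by
    ext s
    simp only [mem_range, Prod.exists, mem_image2, exists_exists_eq_and, Iic_prod_Iic]
  rw [h]
  refine generateFrom_eq_prod hα hβ ⟨fun _ => univ, fun _ => ⟨⊤, Iic_top⟩, iUnion_const _⟩
    ⟨fun _ => univ, fun _ => ⟨⊤, Iic_top⟩, iUnion_const _⟩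

lemma generateFrom_range_Iic_ennreal :
    MeasurableSpace.generateFrom (range (Iic : ℝ≥0∞ → Set ℝ≥0∞)) = ENNReal.measurableSpace := by
  rw [← borel_eq_generateFrom_Iic, BorelSpace.measurable_eq (α := ℝ≥0∞)]

lemma isPiSystem_range_Iic {α : Type*} [SemilatticeInf α] :
    IsPiSystem (range (Iic : α → Set α)) := by
  rintro _ ⟨a, rfl⟩ _ ⟨b, rfl⟩ _
  exact ⟨a ⊓ b, Iic_inter_Iic.symm⟩

/-- The sets `{u₁ ≤ q < u₂}` with `q` rational cover `{u₁ < u₂}`. On each of them the measures are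
finite, and a lower orthant meets the support in a box `u₁ ≤ a`, `q < u₂ ≤ b`. The lower orthants
form a generating π-system, so agreement on ordered boxes suffices. -/
lemma ext_of_ordered_boxes {μ ν : Measure (ℝ≥0∞ × ℝ≥0∞)} (t : ℝ≥0)
    (hμ : ∀ᵐ x ∂μ, x.1 < x.2 ∧ x.2 ≤ (t : ℝ≥0∞)) (hν : ∀ᵐ x ∂ν, x.1 < x.2 ∧ x.2 ≤ (t : ℝ≥0∞))
    (hbox : ∀ a q b : ℝ≥0, a ≤ q → q ≤ b → b ≤ t →
      μ (Iic (a : ℝ≥0∞) ×ˢ Ioc (q : ℝ≥0∞) b) = ν (Iic (a : ℝ≥0∞) ×ˢ Ioc (q : ℝ≥0∞) b))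
    (hfin : ∀ a q b : ℝ≥0, a ≤ q → q ≤ b → b ≤ t →
      μ (Iic (a : ℝ≥0∞) ×ˢ Ioc (q : ℝ≥0∞) b) ≠ ∞) : μ = ν := by
  let R : ℚ → Set (ℝ≥0∞ × ℝ≥0∞) := fun q =>
    Iic (Real.toNNReal q : ℝ≥0∞) ×ˢ Ioi (Real.toNNReal q : ℝ≥0∞)
  have hcov : ∀ x : ℝ≥0∞ × ℝ≥0∞, x.1 < x.2 → x ∈ ⋃ q, R q := by
    intro x hx
    obtain ⟨q, -, h1, h2⟩ := ENNReal.lt_iff_exists_rat_btwn.1 hx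
    exact mem_iUnion.2 ⟨q, h1.le, h2⟩
  rw [← Measure.restrict_eq_self_of_ae_mem (hμ.mono fun x hx => hcov x hx.1),
    ← Measure.restrict_eq_self_of_ae_mem (hν.mono fun x hx => hcov x hx.1),
    Measure.restrict_iUnion_congr]
  intro q
  set q' : ℝ≥0 := Real.toNNReal q
  have key : ∀ x : ℝ≥0∞ × ℝ≥0∞, ∃ a b : ℝ≥0, a ≤ q' ∧ b ≤ t ∧
      ∀ m : Measure (ℝ≥0∞ × ℝ≥0∞), (∀ᵐ x ∂m, x.1 < x.2 ∧ x.2 ≤ (t : ℝ≥0∞)) →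
        m.restrict (R q) (Iic x) = m (Iic (a : ℝ≥0∞) ×ˢ Ioc (q' : ℝ≥0∞) b) := by
    rintro ⟨x1, x2⟩
    have ha : min x1 q' ≠ ∞ := ((min_le_right _ _).trans_lt ENNReal.coe_lt_top).ne
    have hb : min x2 t ≠ ∞ := ((min_le_right _ _).trans_lt ENNReal.coe_lt_top).ne
    refine ⟨(min x1 q').toNNReal, (min x2 t).toNNReal, ?_, ?_, fun m hm => ?_⟩
    · rw [← ENNReal.coe_le_coe, ENNReal.coe_toNNReal ha]; exact min_le_right _ _
    · rw [← ENNReal.coe_le_coe, ENNReal.coe_toNNReal hb]; exact min_le_right _ _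
    · rw [Measure.restrict_apply measurableSet_Iic, ENNReal.coe_toNNReal ha,
        ENNReal.coe_toNNReal hb]
      refine measure_congr ?_
      filter_upwards [hm] with u hu
      refine propext ?_
      change (u.1 ≤ x1 ∧ u.2 ≤ x2) ∧ (u.1 ≤ q' ∧ q' < u.2) ↔
        (u.1 ≤ min x1 q' ∧ q' < u.2 ∧ u.2 ≤ min x2 t)
      rw [le_min_iff, le_min_iff]
      tauto
  have heq : ∀ x, μ.restrict (R q) (Iic x) = ν.restrict (R q) (Iic x) ∧
      μ.restrict (R q) (Iic x) ≠ ∞ := by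
    intro x
    obtain ⟨a, b, ha, hb, h⟩ := key x
    rw [h μ hμ, h ν hν]
    by_cases hqb : q' ≤ b
    · exact ⟨hbox a q' b ha hqb hb, hfin a q' b ha hqb hb⟩
    · have : Ioc (q' : ℝ≥0∞) b = ∅ :=
        Ioc_eq_empty fun h => hqb (by exact_mod_cast h.le)
      simp [this]
  have : IsFiniteMeasure (μ.restrict (R q)) :=
    ⟨by rw [← Iic_top]; exact (heq ⊤).2.lt_top⟩
  refine ext_of_generate_finite _ (generateFrom_range_Iic_prod generateFrom_range_Iic_ennreal
    generateFrom_range_Iic_ennreal).symm isPiSystem_range_Iic ?_ ?_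
  · rintro _ ⟨x, rfl⟩
    exact (heq x).1
  · rw [← Iic_top]
    exact (heq ⊤).1

/-- Points `(u₁, u₂, u₃, u₄)` with `u₁ < u₂ ≤ u₃ < u₄ ≤ t`. -/
def OrderedQuadruple (t : ℝ≥0) (x : ℝ≥0∞ × ℝ≥0∞ × ℝ≥0∞ × ℝ≥0∞) : Prop :=
  x.1 < x.2.1 ∧ x.2.1 ≤ x.2.2.1 ∧ x.2.2.1 < x.2.2.2 ∧ x.2.2.2 ≤ t

/-- The set of `(u₁, u₂, u₃, u₄)` with `u₁ ≤ a`, `q < u₂ ≤ b`, `u₃ ≤ c`, `r < u₄ ≤ d`. -/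
def quadrupleBox (a q b c r d : ℝ≥0) : Set (ℝ≥0∞ × ℝ≥0∞ × ℝ≥0∞ × ℝ≥0∞) :=
  Iic (a : ℝ≥0∞) ×ˢ Ioc (q : ℝ≥0∞) b ×ˢ Iic (c : ℝ≥0∞) ×ˢ Ioc (r : ℝ≥0∞) d

/-- The same argument with two rational separators, one between `u₁` and `u₂` and one between `u₃`
and `u₄`. -/
lemma ext_of_ordered_quadruple_boxes {μ ν : Measure (ℝ≥0∞ × ℝ≥0∞ × ℝ≥0∞ × ℝ≥0∞)} (t : ℝ≥0)
    (hμ : ∀ᵐ x ∂μ, OrderedQuadruple t x) (hν : ∀ᵐ x ∂ν, OrderedQuadruple t x)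
    (hbox : ∀ a q b c r d : ℝ≥0, a ≤ q → q ≤ b → b ≤ c → c ≤ r → r ≤ d → d ≤ t →
      μ (quadrupleBox a q b c r d) = ν (quadrupleBox a q b c r d))
    (hfin : ∀ a q b c r d : ℝ≥0, a ≤ q → q ≤ b → b ≤ c → c ≤ r → r ≤ d → d ≤ t →
      μ (quadrupleBox a q b c r d) ≠ ∞) : μ = ν := by
  let R : ℚ × ℚ → Set (ℝ≥0∞ × ℝ≥0∞ × ℝ≥0∞ × ℝ≥0∞) := fun q =>
    Iic (Real.toNNReal q.1 : ℝ≥0∞) ×ˢ Ioi (Real.toNNReal q.1 : ℝ≥0∞) ×ˢ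
      Iic (Real.toNNReal q.2 : ℝ≥0∞) ×ˢ Ioi (Real.toNNReal q.2 : ℝ≥0∞)
  have hcov : ∀ x, OrderedQuadruple t x → x ∈ ⋃ q, R q := by
    intro x hx
    obtain ⟨q, -, h1, h2⟩ := ENNReal.lt_iff_exists_rat_btwn.1 hx.1
    obtain ⟨r, -, h3, h4⟩ := ENNReal.lt_iff_exists_rat_btwn.1 hx.2.2.1
    exact mem_iUnion.2 ⟨(q, r), h1.le, h2, h3.le, h4⟩
  rw [← Measure.restrict_eq_self_of_ae_mem (hμ.mono fun x hx => hcov x hx),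
    ← Measure.restrict_eq_self_of_ae_mem (hν.mono fun x hx => hcov x hx),
    Measure.restrict_iUnion_congr]
  rintro q
  set q' : ℝ≥0 := Real.toNNReal q.1
  set r' : ℝ≥0 := Real.toNNReal q.2
  have key : ∀ x : ℝ≥0∞ × ℝ≥0∞ × ℝ≥0∞ × ℝ≥0∞, ∃ a b c d : ℝ≥0, a ≤ q' ∧ b ≤ c ∧ c ≤ r' ∧ d ≤ t ∧
      ∀ m : Measure (ℝ≥0∞ × ℝ≥0∞ × ℝ≥0∞ × ℝ≥0∞), (∀ᵐ x ∂m, OrderedQuadruple t x) →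
        m.restrict (R q) (Iic x) = m (quadrupleBox a q' b c r' d) := by
    rintro ⟨x1, x2, x3, x4⟩
    have ha : min x1 q' ≠ ∞ := ((min_le_right _ _).trans_lt ENNReal.coe_lt_top).ne
    have hc : min x3 r' ≠ ∞ := ((min_le_right _ _).trans_lt ENNReal.coe_lt_top).ne
    have hb : min x2 (min x3 r') ≠ ∞ := ((min_le_right _ _).trans_lt hc.lt_top).ne
    have hd : min x4 t ≠ ∞ := ((min_le_right _ _).trans_lt ENNReal.coe_lt_top).ne
    -- The bound on `u₂` is lowered to that on `u₃` to obtain `b ≤ c`; nothing is lost because `u₂ ≤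
    -- u₃` on the support.
    refine ⟨(min x1 q').toNNReal, (min x2 (min x3 r')).toNNReal, (min x3 r').toNNReal,
      (min x4 t).toNNReal, ?_, ?_, ?_, ?_, fun m hm => ?_⟩
    · rw [← ENNReal.coe_le_coe, ENNReal.coe_toNNReal ha]; exact min_le_right _ _
    · rw [← ENNReal.coe_le_coe, ENNReal.coe_toNNReal hb, ENNReal.coe_toNNReal hc]
      exact min_le_right _ _
    · rw [← ENNReal.coe_le_coe, ENNReal.coe_toNNReal hc]; exact min_le_right _ _
    · rw [← ENNReal.coe_le_coe, ENNReal.coe_toNNReal hd]; exact min_le_right _ _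
    · rw [Measure.restrict_apply measurableSet_Iic, quadrupleBox, ENNReal.coe_toNNReal ha,
        ENNReal.coe_toNNReal hb, ENNReal.coe_toNNReal hc, ENNReal.coe_toNNReal hd]
      refine measure_congr ?_
      filter_upwards [hm] with u hu
      refine propext ?_
      change (u.1 ≤ x1 ∧ u.2.1 ≤ x2 ∧ u.2.2.1 ≤ x3 ∧ u.2.2.2 ≤ x4) ∧
        (u.1 ≤ q' ∧ q' < u.2.1 ∧ u.2.2.1 ≤ r' ∧ r' < u.2.2.2) ↔
        (u.1 ≤ min x1 q' ∧ (q' < u.2.1 ∧ u.2.1 ≤ min x2 (min x3 r')) ∧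
          u.2.2.1 ≤ min x3 r' ∧ (r' < u.2.2.2 ∧ u.2.2.2 ≤ min x4 t))
      have h2 : u.2.1 ≤ u.2.2.1 := hu.2.1
      have h4 : u.2.2.2 ≤ t := hu.2.2.2
      simp only [le_min_iff]
      constructor
      · rintro ⟨⟨h1, h2, h3, h4⟩, h5, h6, h7, h8⟩
        exact ⟨⟨h1, h5⟩, ⟨h6, h2, hu.2.1.trans h3, hu.2.1.trans h7⟩, ⟨h3, h7⟩, h8, h4, hu.2.2.2⟩
      · tauto
  have heq : ∀ x, μ.restrict (R q) (Iic x) = ν.restrict (R q) (Iic x) ∧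
      μ.restrict (R q) (Iic x) ≠ ∞ := by
    intro x
    obtain ⟨a, b, c, d, ha, hb, hc, hd, h⟩ := key x
    rw [h μ hμ, h ν hν]
    by_cases hqb : q' ≤ b
    · by_cases hrd : r' ≤ d
      · exact ⟨hbox a q' b c r' d ha hqb hb hc hrd hd, hfin a q' b c r' d ha hqb hb hc hrd hd⟩
      · have : Ioc (r' : ℝ≥0∞) d = ∅ :=
          Ioc_eq_empty fun h => hrd (by exact_mod_cast h.le)
        simp [this, quadrupleBox]
    · have : Ioc (q' : ℝ≥0∞) b = ∅ :=
        Ioc_eq_empty fun h => hqb (by exact_mod_cast h.le)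
      simp [this, quadrupleBox]
  have : IsFiniteMeasure (μ.restrict (R q)) :=
    ⟨by rw [← Iic_top]; exact (heq ⊤).2.lt_top⟩
  have hE := generateFrom_range_Iic_ennreal
  refine ext_of_generate_finite _ (generateFrom_range_Iic_prod hE
    (generateFrom_range_Iic_prod hE (generateFrom_range_Iic_prod hE hE))).symm
    isPiSystem_range_Iic ?_ ?_
  · rintro _ ⟨x, rfl⟩
    exact (heq x).1
  · rw [← Iic_top]
    exact (heq ⊤).1

end AggregateClaims

end

noncomputable section

namespace AggregateClaims

/-! ### The renewal measure of a Poisson process -/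

/-- Base measure for the position of a renewal epoch: an atom at `0` and Lebesgue measure. -/
def epochBase : Measure ℝ := Measure.dirac 0 + volume.restrict (Ioi 0)

/-- Base measure for a waiting time. -/
def waitBase : Measure ℝ := volume.restrict (Ioi 0)

instance : SFinite epochBase := by unfold epochBase; infer_instance

instance : SFinite waitBase := by unfold waitBase; infer_instance

/-- Density, with respect to `epochBase`, of the renewal measure at rate `r`. -/
def epochDensity (r : ℝ≥0) (p : ℝ) : ℝ≥0∞ := if p = 0 then 1 else r

/-- Density of the exponential law of rate `r`. -/
def waitDensity (r : ℝ≥0) (y : ℝ) : ℝ≥0∞ := ENNReal.ofReal (r * Real.exp (-(r * y)))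

@[fun_prop]
lemma measurable_epochDensity {α : Type*} [MeasurableSpace α] {f : α → ℝ≥0} {g : α → ℝ}
    (hf : Measurable f) (hg : Measurable g) : Measurable fun x => epochDensity (f x) (g x) :=
  Measurable.ite (hg (measurableSet_singleton 0)) measurable_const (by fun_prop)

@[fun_prop]
lemma measurable_waitDensity {α : Type*} [MeasurableSpace α] {f : α → ℝ≥0} {g : α → ℝ}
    (hf : Measurable f) (hg : Measurable g) : Measurable fun x => waitDensity (f x) (g x) := by
  unfold waitDensity
  fun_prop

lemma lintegral_epochDensity_mul (r : ℝ≥0) {φ : ℝ → ℝ≥0∞} (hφ : Measurable φ) :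
    ∫⁻ p, epochDensity r p * φ p ∂epochBase = φ 0 + r * ∫⁻ p in Ioi 0, φ p := by
  rw [epochBase, lintegral_add_measure, lintegral_dirac' _ (by fun_prop),
    ← lintegral_const_mul _ hφ]
  congr 1
  · simp [epochDensity]
  · refine setLIntegral_congr_fun measurableSet_Ioi fun p hp => ?_
    simp [epochDensity, (mem_Ioi.1 hp).ne']

lemma ae_epochBase_nonneg : ∀ᵐ p ∂epochBase, 0 ≤ p := by
  rw [epochBase, ae_add_measure_iff]
  refine ⟨by simp, ?_⟩
  filter_upwards [ae_restrict_mem measurableSet_Ioi] with p hp using (mem_Ioi.1 hp).le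

lemma ae_waitBase_pos : ∀ᵐ p ∂waitBase, 0 < p := ae_restrict_mem measurableSet_Ioi

/-- Integral of a function of an epoch and of the waiting time that follows it. -/
def renewalIntegral (r : ℝ≥0) (F : ℝ → ℝ → ℝ≥0∞) : ℝ≥0∞ :=
  ∫⁻ z, epochDensity r z * ∫⁻ v, waitDensity r v * F z v ∂waitBase ∂epochBase

@[fun_prop]
lemma measurable_renewalIntegral {α : Type*} [MeasurableSpace α] {f : α → ℝ≥0}
    (hf : Measurable f) {F : α → ℝ → ℝ → ℝ≥0∞}
    (hF : Measurable fun x : α × ℝ × ℝ => F x.1 x.2.1 x.2.2) :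
    Measurable fun x => renewalIntegral (f x) (F x) := by
  unfold renewalIntegral
  have : Measurable fun x : (α × ℝ) × ℝ => F x.1.1 x.1.2 x.2 :=
    hF.comp (by fun_prop : Measurable fun x : (α × ℝ) × ℝ => (x.1.1, x.1.2, x.2))
  fun_prop

lemma renewalIntegral_congr {r : ℝ≥0} {F G : ℝ → ℝ → ℝ≥0∞}
    (h : ∀ z v, 0 ≤ z → 0 < v → F z v = G z v) : renewalIntegral r F = renewalIntegral r G := by
  refine lintegral_congr_ae ?_
  filter_upwards [ae_epochBase_nonneg] with z hz
  congr 1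
  refine lintegral_congr_ae ?_
  filter_upwards [ae_waitBase_pos] with v hv
  rw [h z v hz hv]

lemma renewalIntegral_const_mul {r : ℝ≥0} {F : ℝ → ℝ → ℝ≥0∞}
    (hF : Measurable fun x : ℝ × ℝ => F x.1 x.2) (c : ℝ≥0∞) :
    renewalIntegral r (fun z v => c * F z v) = c * renewalIntegral r F := by
  unfold renewalIntegral
  rw [← lintegral_const_mul _ (by fun_prop)]
  refine lintegral_congr fun z => ?_
  rw [mul_left_comm, ← lintegral_const_mul c (by fun_prop)]
  simp only [mul_left_comm c]

lemma setLIntegral_exp (k : ℝ) (hk : 0 ≤ k) {a b : ℝ} (hab : a ≤ b) :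
    ∫⁻ x in Ioc a b, ENNReal.ofReal (k * Real.exp (k * x)) =
      ENNReal.ofReal (Real.exp (k * b) - Real.exp (k * a)) := by
  have hc : Continuous fun x => k * Real.exp (k * x) := by fun_prop
  rw [← ofReal_integral_eq_lintegral_ofReal
    ((hc.integrableOn_Icc).mono_set Ioc_subset_Icc_self)
    (ae_of_all _ fun x => mul_nonneg hk (Real.exp_nonneg _)),
    ← intervalIntegral.integral_of_le hab,
    intervalIntegral.integral_eq_sub_of_hasDerivAt (f := fun x => Real.exp (k * x))
      (fun x _ => ?_) (hc.intervalIntegrable _ _)]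
  simpa [mul_comm] using ((hasDerivAt_id x).const_mul k).exp

lemma setLIntegral_waitDensity (r : ℝ≥0) {a b : ℝ} (hab : a ≤ b) :
    ∫⁻ x in Ioc a b, waitDensity r x =
      ENNReal.ofReal (Real.exp (-(r * a)) - Real.exp (-(r * b))) := by
  unfold waitDensity
  have hc : Continuous fun x : ℝ => (r : ℝ) * Real.exp (-(r * x)) := by fun_prop
  rw [← ofReal_integral_eq_lintegral_ofReal
    ((hc.integrableOn_Icc).mono_set Ioc_subset_Icc_self)
    (ae_of_all _ fun x => mul_nonneg r.coe_nonneg (Real.exp_nonneg _)),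
    ← intervalIntegral.integral_of_le hab,
    intervalIntegral.integral_eq_sub_of_hasDerivAt (f := fun x => -Real.exp (-(r * x)))
      (fun x _ => ?_) (hc.intervalIntegrable _ _)]
  · ring_nf
  · have := ((hasDerivAt_id x).const_mul (r : ℝ)).neg.exp.neg
    exact HasDerivAt.congr_deriv (f := fun x => -Real.exp (-(r * x))) this (by simp [mul_comm])

/-- An epoch at `w + z ≤ c` is followed by a next one in `(q, d]` with probability `e^{r(w+z)}
(e^{-rq} - e^{-rd})`. Against `δ₀ + r dz` on `[0, c - w]` the first factor integrates to `e^{rw} +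
(e^{rc} - e^{rw}) = e^{rc}`. The starting point `w` drops out: this is lack of memory, and it makes
the masses of quadruple boxes factor. -/
lemma renewalIntegral_indicator_box (r : ℝ≥0) {w c q d : ℝ} (hwc : w ≤ c) (hcq : c ≤ q)
    (hqd : q ≤ d) :
    renewalIntegral r (fun z v => if w + z ≤ c ∧ q < w + z + v ∧ w + z + v ≤ d then 1 else 0) =
      ENNReal.ofReal (Real.exp (-(r * (q - c))) - Real.exp (-(r * (d - c)))) := by
  have h1 : ∀ z : ℝ, 0 ≤ z → ∫⁻ v, waitDensity r v *
      (if w + z ≤ c ∧ q < w + z + v ∧ w + z + v ≤ d then 1 else 0) ∂waitBase =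
      (Iic (c - w)).indicator (fun z => ENNReal.ofReal (Real.exp (r * (w + z))) *
        ENNReal.ofReal (Real.exp (-(r * q)) - Real.exp (-(r * d)))) z := by
    intro z hz
    by_cases hzc : z ≤ c - w
    · rw [indicator_of_mem (show z ∈ Iic (c - w) from hzc), ← ENNReal.ofReal_mul (Real.exp_nonneg _)]
      have : ∀ v, waitDensity r v *
          (if w + z ≤ c ∧ q < w + z + v ∧ w + z + v ≤ d then 1 else 0) =
          (Ioc (q - w - z) (d - w - z)).indicator (waitDensity r) v := by
        intro v
        by_cases hv : v ∈ Ioc (q - w - z) (d - w - z)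
        · rw [indicator_of_mem hv, if_pos, mul_one]
          exact ⟨by linarith, by linarith [hv.1], by linarith [hv.2]⟩
        · rw [indicator_of_notMem hv, if_neg, mul_zero]
          rintro ⟨-, h1, h2⟩
          exact hv ⟨by linarith, by linarith⟩
      simp_rw [this]
      rw [waitBase, lintegral_indicator measurableSet_Ioc, Measure.restrict_restrict measurableSet_Ioc,
        inter_eq_left.2, setLIntegral_waitDensity r (by linarith)]
      · congr 1
        rw [mul_sub (Real.exp _), ← Real.exp_add, ← Real.exp_add]
        ring_nf
      · intro v hv
        exact lt_of_le_of_lt (by linarith) hv.1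
    · rw [indicator_of_notMem (show z ∉ Iic (c - w) from hzc)]
      have : ∀ v, ¬ (w + z ≤ c ∧ q < w + z + v ∧ w + z + v ≤ d) :=
        fun v h => hzc (by linarith [h.1])
      simp [this]
  unfold renewalIntegral
  have h2 : ∫⁻ z, epochDensity r z * ∫⁻ v, waitDensity r v *
      (if w + z ≤ c ∧ q < w + z + v ∧ w + z + v ≤ d then 1 else 0) ∂waitBase ∂epochBase =
      ∫⁻ z, epochDensity r z * (Iic (c - w)).indicator
        (fun z => ENNReal.ofReal (Real.exp (r * (w + z))) *
        ENNReal.ofReal (Real.exp (-(r * q)) - Real.exp (-(r * d)))) z ∂epochBase := by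
    refine lintegral_congr_ae ?_
    filter_upwards [ae_epochBase_nonneg] with z hz
    rw [h1 z hz]
  rw [h2, lintegral_epochDensity_mul r (Measurable.indicator (by fun_prop) measurableSet_Iic),
    indicator_of_mem (show (0 : ℝ) ∈ Iic (c - w) from sub_nonneg.2 hwc),
    lintegral_indicator measurableSet_Iic, Measure.restrict_restrict measurableSet_Iic,
    inter_comm, Ioi_inter_Iic, lintegral_mul_const _ (by fun_prop), ← mul_assoc, ← add_mul,
    ← ENNReal.ofReal_coe_nnreal, ← lintegral_const_mul _ (by fun_prop)]
  have h3 : ∀ z : ℝ, ENNReal.ofReal r * ENNReal.ofReal (Real.exp (r * (w + z))) =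
      ENNReal.ofReal (Real.exp (r * w)) * ENNReal.ofReal (r * Real.exp (r * z)) := by
    intro z
    rw [← ENNReal.ofReal_mul r.coe_nonneg, ← ENNReal.ofReal_mul (Real.exp_nonneg _), mul_add, Real.exp_add]
    ring_nf
  simp_rw [h3]
  rw [lintegral_const_mul _ (by fun_prop), setLIntegral_exp _ r.coe_nonneg (sub_nonneg.2 hwc), add_zero,
    ← ENNReal.ofReal_mul (Real.exp_nonneg _), ← ENNReal.ofReal_add (Real.exp_nonneg _),
    ← ENNReal.ofReal_mul]
  · congr 1
    rw [mul_zero, Real.exp_zero, mul_sub (Real.exp _), mul_one, add_sub_cancel,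
      ← Real.exp_add, mul_sub (Real.exp _), ← Real.exp_add, ← Real.exp_add]
    ring_nf
  · rw [mul_zero, Real.exp_zero, mul_sub (Real.exp _), mul_one, add_sub_cancel,
      ← Real.exp_add]
    exact Real.exp_nonneg _
  · refine mul_nonneg (Real.exp_nonneg _) (sub_nonneg.2 (Real.exp_le_exp.2 ?_))
    exact mul_le_mul_of_nonneg_left (sub_nonneg.2 hwc) r.coe_nonneg

/-- Expected number of renewals of a Poisson process of rate `r` in `[0, s]`, counting the one
at `0`. -/
lemma lintegral_epochDensity_indicator (r : ℝ≥0) (s : ℝ) :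
    ∫⁻ z, epochDensity r z * (if z ≤ s then 1 else 0) ∂epochBase =
      if 0 ≤ s then ENNReal.ofReal (1 + r * s) else 0 := by
  rw [lintegral_epochDensity_mul r (Measurable.ite measurableSet_Iic (by fun_prop) (by fun_prop))]
  have h : (fun z : ℝ => if z ≤ s then (1 : ℝ≥0∞) else 0) = (Iic s).indicator 1 := by
    ext z; simp [indicator_apply]
  rw [h, lintegral_indicator measurableSet_Iic, Measure.restrict_restrict measurableSet_Iic,
    inter_comm, Ioi_inter_Iic]
  simp only [Pi.one_apply, lintegral_const, one_mul, Measure.restrict_apply MeasurableSet.univ,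
    univ_inter, Real.volume_Ioc, sub_zero]
  split_ifs with hs
  · rw [← ENNReal.ofReal_coe_nnreal, ← ENNReal.ofReal_mul r.coe_nonneg, ← ENNReal.ofReal_one,
      ← ENNReal.ofReal_add zero_le_one (mul_nonneg r.coe_nonneg hs)]
  · rw [ENNReal.ofReal_of_nonpos (by linarith)]
    simp

/-- This is where the quadratic weight comes from: `1 + rs + r ∫₀ˢ (1 + r (s - p)) dp = 1 + 2rs +
(rs)² / 2`, the expected number of ways to fit two successive free epochs into `[0, s]`. -/
lemma lintegral_epochDensity_mul_linear (r : ℝ≥0) (s : ℝ) :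
    ∫⁻ p, epochDensity r p * (if p ≤ s then ENNReal.ofReal (1 + r * (s - p)) else 0) ∂epochBase =
      if 0 ≤ s then ENNReal.ofReal (((r * s + 2) ^ 2 - 2) / 2) else 0 := by
  rw [lintegral_epochDensity_mul r (Measurable.ite measurableSet_Iic (by fun_prop) (by fun_prop))]
  have h : (fun z : ℝ => if z ≤ s then ENNReal.ofReal (1 + r * (s - z)) else 0) =
      (Iic s).indicator fun z => ENNReal.ofReal (1 + r * (s - z)) := by
    ext z; simp [indicator_apply]
  rw [h, lintegral_indicator measurableSet_Iic, Measure.restrict_restrict measurableSet_Iic,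
    inter_comm, Ioi_inter_Iic]
  split_ifs with hs
  · have hc : Continuous fun z : ℝ => 1 + (r : ℝ) * (s - z) := by fun_prop
    have hn : 0 ≤ᵐ[volume.restrict (Ioc 0 s)] fun z => 1 + (r : ℝ) * (s - z) := by
      filter_upwards [ae_restrict_mem measurableSet_Ioc] with z hz
      exact add_nonneg zero_le_one (mul_nonneg r.coe_nonneg (sub_nonneg.2 hz.2))
    have hI : ∫ z in (0 : ℝ)..s, (1 + (r : ℝ) * (s - z)) = s + r * s ^ 2 / 2 := by
      rw [intervalIntegral.integral_eq_sub_of_hasDerivAt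
        (f := fun z => z + r * (s * z - z ^ 2 / 2)) (fun x _ => ?_) (hc.intervalIntegrable _ _)]
      · ring
      · have h1 := (hasDerivAt_id x).add ((((hasDerivAt_id x).const_mul s).sub
          (((hasDerivAt_id x).pow 2).div_const 2)).const_mul (r : ℝ))
        exact HasDerivAt.congr_deriv (f := fun z => z + r * (s * z - z ^ 2 / 2)) h1 (by simp)
    rw [← ofReal_integral_eq_lintegral_ofReal ((hc.integrableOn_Icc).mono_set Ioc_subset_Icc_self) hn,
      ← intervalIntegral.integral_of_le hs, hI, ← ENNReal.ofReal_coe_nnreal,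
      ← ENNReal.ofReal_mul r.coe_nonneg, ← ENNReal.ofReal_add]
    · congr 1; ring
    · have := mul_nonneg r.coe_nonneg hs
      linarith [show (0 : ℝ) ≤ r * (s - 0) by simpa using this]
    · have := r.coe_nonneg
      positivity
  · simp [Ioc_eq_empty (fun h : 0 < s => hs h.le)]

/-- The sum of `h` over the interarrival times of a Poisson process in `[w, s]`. -/
lemma renewalIntegral_sum (r : ℝ≥0) {h : ℝ → ℝ≥0∞} (hh : Measurable h) (s : ℝ) :
    renewalIntegral r (fun z v => if z + v ≤ s then h v else 0) =
      ∫⁻ v in Ioc 0 s, waitDensity r v * (ENNReal.ofReal (1 + r * (s - v)) * h v) := by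
  have hm : MeasurableSet {x : ℝ × ℝ | x.1 + x.2 ≤ s} :=
    measurableSet_le (by fun_prop) (by fun_prop)
  have hm2 : Measurable fun x : ℝ × ℝ => if x.1 + x.2 ≤ s then h x.2 else 0 :=
    Measurable.ite hm (by fun_prop) (by fun_prop)
  have hm3 : ∀ v : ℝ, Measurable fun z : ℝ => if z ≤ s - v then (1 : ℝ≥0∞) else 0 :=
    fun v => Measurable.ite measurableSet_Iic (by fun_prop) (by fun_prop)
  unfold renewalIntegral
  have hm4 : ∀ z, Measurable fun v => waitDensity r v * (if z + v ≤ s then h v else 0) := by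
    intro z
    have := hm2.comp (by fun_prop : Measurable fun v : ℝ => (z, v))
    exact Measurable.mul (by fun_prop) this
  simp_rw [← lintegral_const_mul _ (hm4 _)]
  rw [lintegral_lintegral_swap (by
    apply Measurable.aemeasurable
    unfold Function.uncurry
    fun_prop)]
  have h1 : ∀ v, ∫⁻ z, epochDensity r z * (waitDensity r v * if z + v ≤ s then h v else 0)
      ∂epochBase = (Iic s).indicator
        (fun v => waitDensity r v * (ENNReal.ofReal (1 + r * (s - v)) * h v)) v := by
    intro v
    have h2 : ∀ z, epochDensity r z * (waitDensity r v * if z + v ≤ s then h v else 0) =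
        (epochDensity r z * (if z ≤ s - v then 1 else 0)) * (waitDensity r v * h v) := by
      intro z
      simp only [← le_sub_iff_add_le]
      split_ifs <;> simp
    simp_rw [h2]
    rw [lintegral_mul_const _ (by have := hm3 v; fun_prop), lintegral_epochDensity_indicator,
      indicator_apply]
    simp only [mem_Iic, sub_nonneg]
    split_ifs
    · ring
    · simp
  simp_rw [h1]
  rw [waitBase, lintegral_indicator measurableSet_Iic, Measure.restrict_restrict measurableSet_Iic,
    inter_comm, Ioi_inter_Iic]

end AggregateClaims

end

noncomputable section

namespace AggregateClaims

/-! ### Pairs of waiting times, with both epochs integrated out. -/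

lemma lintegral_waitBase_ite {g : ℝ → ℝ≥0∞} (s : ℝ) :
    ∫⁻ v, (if v ≤ s then g v else 0) ∂waitBase = ∫⁻ v in Ioc 0 s, g v := by
  have h : (fun v : ℝ => if v ≤ s then g v else 0) = (Iic s).indicator g := by
    ext z; simp [indicator_apply]
  rw [h, waitBase, lintegral_indicator measurableSet_Iic,
    Measure.restrict_restrict measurableSet_Iic, inter_comm, Ioi_inter_Iic]

/-- The sum of `H` over the pairs of distinct interarrival times, in their order, of a Poisson
process in `[0, t]`. -/
lemma renewalIntegral_pair_sum (r : ℝ≥0) {H : ℝ → ℝ → ℝ≥0∞}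
    (hH : Measurable fun x : ℝ × ℝ => H x.1 x.2) (t : ℝ) :
    renewalIntegral r (fun p y => renewalIntegral r fun z v =>
        if p + y + z + v ≤ t then H y v else 0) =
      ∫⁻ y in Ioc 0 t, ∫⁻ v in Ioc 0 (t - y), waitDensity r y * (waitDensity r v *
        (ENNReal.ofReal (((r * (t - y - v) + 2) ^ 2 - 2) / 2) * H y v)) := by
  -- `K p (y, v)` is the expected number of epochs `z` of the second renewal that leave room for
  -- `p`, `y` and `v` before `t`.
  let K : ℝ → ℝ × ℝ → ℝ≥0∞ := fun p x =>
    if p ≤ t - x.1 - x.2 then ENNReal.ofReal (1 + r * (t - x.1 - x.2 - p)) else 0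
  have hK : Measurable (Function.uncurry K) :=
    Measurable.ite (measurableSet_le (by fun_prop) (by fun_prop)) (by fun_prop) (by fun_prop)
  have h1 : ∀ p y, renewalIntegral r (fun z v => if p + y + z + v ≤ t then H y v else 0) =
      ∫⁻ v, waitDensity r v * (K p (y, v) * H y v) ∂waitBase := by
    intro p y
    have h2 : ∀ z v, (if p + y + z + v ≤ t then H y v else 0) =
        if z + v ≤ t - p - y then H y v else 0 := by
      intro z v
      refine if_congr ?_ rfl rfl
      constructor <;> intro h <;> linarith
    simp_rw [h2]
    rw [renewalIntegral_sum r (h := H y) (hH.comp (by fun_prop : Measurable fun v => (y, v))),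
      ← lintegral_waitBase_ite]
    refine lintegral_congr fun v => ?_
    have h3 : v ≤ t - p - y ↔ p ≤ t - y - v := by constructor <;> intro h <;> linarith
    simp only [K, h3]
    split_ifs
    · rw [show t - p - y - v = t - y - v - p by ring]
    · simp
  simp_rw [h1]
  unfold renewalIntegral
  have hm : Measurable fun x : ℝ × ℝ × ℝ => epochDensity r x.1 *
      (waitDensity r x.2.1 * (waitDensity r x.2.2 * (K x.1 x.2 * H x.2.1 x.2.2))) := by
    have : Measurable fun x : ℝ × ℝ × ℝ => K x.1 x.2 := hK
    have : Measurable fun x : ℝ × ℝ × ℝ => H x.2.1 x.2.2 := hH.comp measurable_snd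
    fun_prop
  have hm1 : ∀ p, Measurable fun x : ℝ × ℝ => epochDensity r p *
      (waitDensity r x.1 * (waitDensity r x.2 * (K p x * H x.1 x.2))) :=
    fun p => hm.comp (by fun_prop : Measurable fun x : ℝ × ℝ => (p, x))
  have hm2 : ∀ p, Measurable fun x : ℝ × ℝ =>
      waitDensity r x.2 * (K p x * H x.1 x.2) := fun p => by
    have : Measurable fun x : ℝ × ℝ => K p x :=
      hK.comp (by fun_prop : Measurable fun x : ℝ × ℝ => (p, x))
    fun_prop
  have h4 : ∀ p, epochDensity r p * ∫⁻ y, waitDensity r y *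
      ∫⁻ v, waitDensity r v * (K p (y, v) * H y v) ∂waitBase ∂waitBase =
      ∫⁻ x : ℝ × ℝ, epochDensity r p * (waitDensity r x.1 * (waitDensity r x.2 *
        (K p x * H x.1 x.2))) ∂(waitBase.prod waitBase) := by
    intro p
    have hm3 : Measurable fun y => ∫⁻ v, waitDensity r v * (K p (y, v) * H y v) ∂waitBase :=
      (hm2 p).lintegral_prod_right'
    rw [lintegral_prod _ (hm1 p).aemeasurable, ← lintegral_const_mul _ (by fun_prop)]
    refine lintegral_congr fun y => ?_
    have h5 : Measurable fun v => waitDensity r v * (K p (y, v) * H y v) :=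
      (hm2 p).comp (by fun_prop : Measurable fun v : ℝ => (y, v))
    rw [← lintegral_const_mul _ h5, ← lintegral_const_mul _ (by fun_prop)]
  simp_rw [h4]
  -- The first epoch `p` becomes the innermost variable, so that the linear weight `K` integrates to
  -- the quadratic one.
  rw [lintegral_lintegral_swap hm.aemeasurable]
  have h6 : ∀ x : ℝ × ℝ, ∫⁻ p, epochDensity r p * (waitDensity r x.1 * (waitDensity r x.2 *
        (K p x * H x.1 x.2))) ∂epochBase =
      if x.1 + x.2 ≤ t then waitDensity r x.1 * (waitDensity r x.2 *
        (ENNReal.ofReal (((r * (t - x.1 - x.2) + 2) ^ 2 - 2) / 2) * H x.1 x.2)) else 0 := by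
    intro x
    have h7 : ∀ p, epochDensity r p * (waitDensity r x.1 * (waitDensity r x.2 *
        (K p x * H x.1 x.2))) = (waitDensity r x.1 * (waitDensity r x.2 * H x.1 x.2)) *
        (epochDensity r p * K p x) := fun p => by ring
    simp_rw [h7]
    have h8 : Measurable fun p => K p x :=
      hK.comp (by fun_prop : Measurable fun p : ℝ => (p, x))
    rw [lintegral_const_mul _ (by fun_prop), lintegral_epochDensity_mul_linear]
    have h9 : 0 ≤ t - x.1 - x.2 ↔ x.1 + x.2 ≤ t := by constructor <;> intro h <;> linarith
    simp only [h9]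
    split_ifs
    · ring
    · simp
  simp_rw [h6]
  have hm3 : Measurable fun x : ℝ × ℝ =>
      if x.1 + x.2 ≤ t then waitDensity r x.1 * (waitDensity r x.2 *
        (ENNReal.ofReal (((r * (t - x.1 - x.2) + 2) ^ 2 - 2) / 2) * H x.1 x.2)) else 0 :=
    Measurable.ite (measurableSet_le (by fun_prop) (by fun_prop)) (by fun_prop) (by fun_prop)
  rw [lintegral_prod _ hm3.aemeasurable, ← lintegral_waitBase_ite]
  refine lintegral_congr fun y => ?_
  simp only [← le_sub_iff_add_le']
  rw [lintegral_waitBase_ite]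
  split_ifs with h
  · rfl
  · rw [Ioc_eq_empty (fun h' => h (by linarith)), Measure.restrict_empty, lintegral_zero_measure]

/-! ### The law of consecutive arrival times in the mixed Poisson process -/

/-- Intensity of the consecutive arrival times `(T i, T (i + 1))` of a mixed Poisson process. -/
def consecutiveIntensity (L : Measure ℝ≥0) : Measure (ℝ≥0∞ × ℝ≥0∞) :=
  ((L.prod (epochBase.prod waitBase)).withDensity
    fun x => epochDensity x.1 x.2.1 * waitDensity x.1 x.2.2).map
    fun x => (ENNReal.ofReal x.2.1, ENNReal.ofReal (x.2.1 + x.2.2))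

/-- Intensity of `(T i, T (i + 1), T j, T (j + 1))`, `i < j`, of a mixed Poisson process. -/
def quadrupleIntensity (L : Measure ℝ≥0) : Measure (ℝ≥0∞ × ℝ≥0∞ × ℝ≥0∞ × ℝ≥0∞) :=
  ((L.prod (epochBase.prod (waitBase.prod (epochBase.prod waitBase)))).withDensity
    fun x => epochDensity x.1 x.2.1 * (waitDensity x.1 x.2.2.1 *
      (epochDensity x.1 x.2.2.2.1 * waitDensity x.1 x.2.2.2.2))).map
    fun x => (ENNReal.ofReal x.2.1, ENNReal.ofReal (x.2.1 + x.2.2.1),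
      ENNReal.ofReal (x.2.1 + x.2.2.1 + x.2.2.2.1),
      ENNReal.ofReal (x.2.1 + x.2.2.1 + x.2.2.2.1 + x.2.2.2.2))

variable {L : Measure ℝ≥0}

lemma lintegral_consecutiveIntensity {F : ℝ≥0∞ × ℝ≥0∞ → ℝ≥0∞}
    (hF : Measurable F) :
    ∫⁻ u, F u ∂consecutiveIntensity L =
      ∫⁻ r, renewalIntegral r (fun z v => F (ENNReal.ofReal z, ENNReal.ofReal (z + v))) ∂L := by
  rw [consecutiveIntensity, lintegral_map hF (by fun_prop),
    lintegral_withDensity_eq_lintegral_mul _ (by fun_prop) (by fun_prop),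
    lintegral_prod _ (by apply Measurable.aemeasurable; simp only [Pi.mul_def]; fun_prop)]
  refine lintegral_congr fun r => ?_
  rw [lintegral_prod _ (by apply Measurable.aemeasurable; simp only [Pi.mul_def]; fun_prop)]
  refine lintegral_congr fun z => ?_
  rw [← lintegral_const_mul _ (by fun_prop)]
  simp only [Pi.mul_apply, mul_assoc]

lemma lintegral_quadrupleIntensity {F : ℝ≥0∞ × ℝ≥0∞ × ℝ≥0∞ × ℝ≥0∞ → ℝ≥0∞}
    (hF : Measurable F) :
    ∫⁻ u, F u ∂quadrupleIntensity L =
      ∫⁻ r, renewalIntegral r (fun p y => renewalIntegral r fun z v =>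
        F (ENNReal.ofReal p, ENNReal.ofReal (p + y), ENNReal.ofReal (p + y + z),
          ENNReal.ofReal (p + y + z + v))) ∂L := by
  rw [quadrupleIntensity, lintegral_map hF (by fun_prop),
    lintegral_withDensity_eq_lintegral_mul _ (by fun_prop) (by fun_prop),
    lintegral_prod _ (by apply Measurable.aemeasurable; simp only [Pi.mul_def]; fun_prop)]
  refine lintegral_congr fun r => ?_
  rw [lintegral_prod _ (by apply Measurable.aemeasurable; simp only [Pi.mul_def]; fun_prop)]
  refine lintegral_congr fun p => ?_
  rw [← lintegral_const_mul _ (by fun_prop),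
    lintegral_prod _ (by apply Measurable.aemeasurable; simp only [Pi.mul_def]; fun_prop)]
  refine lintegral_congr fun y => ?_
  rw [lintegral_prod _ (by apply Measurable.aemeasurable; simp only [Pi.mul_def]; fun_prop)]
  unfold renewalIntegral
  rw [← lintegral_const_mul _ (by fun_prop), ← lintegral_const_mul _ (by fun_prop)]
  refine lintegral_congr fun z => ?_
  rw [← lintegral_const_mul _ (by fun_prop), ← lintegral_const_mul _ (by fun_prop),
    ← lintegral_const_mul _ (by fun_prop)]
  simp only [Pi.mul_apply, mul_assoc]

lemma renewalIntegral_zero (r : ℝ≥0) : renewalIntegral r (fun _ _ => 0) = 0 := by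
  simp [renewalIntegral]

lemma ae_consecutiveIntensity : ∀ᵐ u ∂consecutiveIntensity L, u.1 < u.2 := by
  have hm : MeasurableSet {u : ℝ≥0∞ × ℝ≥0∞ | ¬ u.1 < u.2} :=
    (measurableSet_lt measurable_fst measurable_snd).compl
  rw [ae_iff, ← lintegral_indicator_one hm,
    lintegral_consecutiveIntensity (measurable_one.indicator hm)]
  simp only [indicator_apply, mem_ofPred_eq]
  rw [lintegral_congr (g := fun _ => 0), lintegral_zero]
  intro r
  refine (renewalIntegral_congr fun z v hz hv => if_neg (not_not.2 ?_)).trans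
    (renewalIntegral_zero r)
  exact (ENNReal.ofReal_lt_ofReal_iff (by linarith)).2 (by linarith)

lemma ae_quadrupleIntensity :
    ∀ᵐ u ∂quadrupleIntensity L, u.1 < u.2.1 ∧ u.2.1 ≤ u.2.2.1 ∧ u.2.2.1 < u.2.2.2 := by
  have hm : MeasurableSet {u : ℝ≥0∞ × ℝ≥0∞ × ℝ≥0∞ × ℝ≥0∞ |
      ¬ (u.1 < u.2.1 ∧ u.2.1 ≤ u.2.2.1 ∧ u.2.2.1 < u.2.2.2)} :=
    ((measurableSet_lt measurable_fst measurable_snd.fst).inter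
      ((measurableSet_le measurable_snd.fst measurable_snd.snd.fst).inter
        (measurableSet_lt measurable_snd.snd.fst measurable_snd.snd.snd))).compl
  rw [ae_iff, ← lintegral_indicator_one hm,
    lintegral_quadrupleIntensity (measurable_one.indicator hm)]
  simp only [indicator_apply, mem_ofPred_eq]
  rw [lintegral_congr (g := fun _ => 0), lintegral_zero]
  intro r
  refine (renewalIntegral_congr fun p y hp hy => (renewalIntegral_congr fun z v hz hv =>
    if_neg (not_not.2 ?_)).trans (renewalIntegral_zero r)).trans (renewalIntegral_zero r)
  exact ⟨(ENNReal.ofReal_lt_ofReal_iff (by linarith)).2 (by linarith),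
    ENNReal.ofReal_le_ofReal (by linarith),
    (ENNReal.ofReal_lt_ofReal_iff (by linarith)).2 (by linarith)⟩

lemma ofReal_le_coe_iff {x : ℝ} {a : ℝ≥0} : ENNReal.ofReal x ≤ a ↔ x ≤ a := by
  rw [← ENNReal.ofReal_coe_nnreal, ENNReal.ofReal_le_ofReal_iff a.coe_nonneg]

lemma coe_lt_ofReal_iff {x : ℝ} {a : ℝ≥0} : (a : ℝ≥0∞) < ENNReal.ofReal x ↔ a < x := by
  rw [← ENNReal.ofReal_coe_nnreal, ENNReal.ofReal_lt_ofReal_iff_of_nonneg a.coe_nonneg]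

lemma consecutiveIntensity_box {a q b : ℝ≥0} (haq : a ≤ q) (hqb : q ≤ b) :
    consecutiveIntensity L (Iic (a : ℝ≥0∞) ×ˢ Ioc (q : ℝ≥0∞) b) = ∫⁻ r, gapProb a q b r ∂L := by
  have hm : MeasurableSet (Iic (a : ℝ≥0∞) ×ˢ Ioc (q : ℝ≥0∞) b) :=
    measurableSet_Iic.prod measurableSet_Ioc
  rw [← lintegral_indicator_one hm, lintegral_consecutiveIntensity (measurable_one.indicator hm)]
  refine lintegral_congr fun r => ?_
  rw [gapProb, ← renewalIntegral_indicator_box r (w := 0) a.coe_nonneg (NNReal.coe_le_coe.2 haq)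
    (NNReal.coe_le_coe.2 hqb)]
  congr 1
  ext z v
  simp only [indicator_apply, mem_prod, mem_Iic, mem_Ioc, ofReal_le_coe_iff, coe_lt_ofReal_iff,
    zero_add, Pi.one_apply]

lemma quadrupleIntensity_box {a q b c r d : ℝ≥0} (haq : a ≤ q) (hqb : q ≤ b) (hbc : b ≤ c)
    (hcr : c ≤ r) (hrd : r ≤ d) :
    quadrupleIntensity L (quadrupleBox a q b c r d) =
      ∫⁻ x, gapProb a q b x * gapProb c r d x ∂L := by
  have hm : MeasurableSet (quadrupleBox a q b c r d) :=
    measurableSet_Iic.prod (measurableSet_Ioc.prod (measurableSet_Iic.prod measurableSet_Ioc))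
  rw [← lintegral_indicator_one hm, lintegral_quadrupleIntensity (measurable_one.indicator hm)]
  refine lintegral_congr fun x => ?_
  -- The second renewal starts at `w = p + y ≤ b ≤ c`, and its box mass does not depend on `w`. It
  -- leaves the first integral as a constant factor.
  have h1 : ∀ p y, renewalIntegral x (fun z v => (quadrupleBox a q b c r d).indicator
      (1 : ℝ≥0∞ × ℝ≥0∞ × ℝ≥0∞ × ℝ≥0∞ → ℝ≥0∞) (ENNReal.ofReal p, ENNReal.ofReal (p + y), ENNReal.ofReal (p + y + z),
          ENNReal.ofReal (p + y + z + v))) =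
      gapProb c r d x * (if 0 + p ≤ a ∧ q < 0 + p + y ∧ 0 + p + y ≤ b then 1 else 0) := by
    intro p y
    rw [zero_add]
    split_ifs with h
    · rw [mul_one, gapProb, ← renewalIntegral_indicator_box x (w := p + y)
        (h.2.2.trans (NNReal.coe_le_coe.2 hbc)) (NNReal.coe_le_coe.2 hcr)
        (NNReal.coe_le_coe.2 hrd)]
      congr 1
      ext z v
      simp only [quadrupleBox, indicator_apply, mem_prod, mem_Iic, mem_Ioc, ofReal_le_coe_iff,
        coe_lt_ofReal_iff, Pi.one_apply]
      refine if_congr ?_ rfl rfl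
      tauto
    · rw [mul_zero, ← renewalIntegral_zero x]
      congr 1
      ext z v
      refine indicator_of_notMem (fun hmem => h ?_) _
      simp only [quadrupleBox, mem_prod, mem_Iic, mem_Ioc, ofReal_le_coe_iff,
        coe_lt_ofReal_iff] at hmem
      tauto
  simp_rw [h1]
  have hm' : Measurable fun u : ℝ × ℝ =>
      if 0 + u.1 ≤ a ∧ q < 0 + u.1 + u.2 ∧ 0 + u.1 + u.2 ≤ b then (1 : ℝ≥0∞) else 0 := by
    refine Measurable.ite ?_ measurable_const measurable_const
    have h1 : MeasurableSet {u : ℝ × ℝ | 0 + u.1 ≤ a} :=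
      measurableSet_le (by fun_prop) (by fun_prop)
    have h2 : MeasurableSet {u : ℝ × ℝ | q < 0 + u.1 + u.2} :=
      measurableSet_lt (by fun_prop) (by fun_prop)
    have h3 : MeasurableSet {u : ℝ × ℝ | 0 + u.1 + u.2 ≤ b} :=
      measurableSet_le (by fun_prop) (by fun_prop)
    exact h1.inter (h2.inter h3)
  rw [renewalIntegral_const_mul hm',
    renewalIntegral_indicator_box x (w := 0) a.coe_nonneg (NNReal.coe_le_coe.2 haq)
    (NNReal.coe_le_coe.2 hqb), mul_comm]
  rfl

lemma lintegral_consecutiveIntensity_wait {H : ℝ≥0∞ → ℝ≥0∞} (hH : Measurable H) (t : ℝ≥0) :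
    ∫⁻ u, (if u.2 ≤ (t : ℝ≥0∞) then H (u.2 - u.1) else 0) ∂consecutiveIntensity L =
      ∫⁻ r : ℝ≥0, (∫⁻ v : ℝ in Ioc 0 (t : ℝ), waitDensity r v *
        (ENNReal.ofReal (1 + r * (t - v)) * H (ENNReal.ofReal v))) ∂L := by
  rw [lintegral_consecutiveIntensity (Measurable.ite (measurableSet_le (by fun_prop) (by fun_prop))
    (by fun_prop) (by fun_prop))]
  refine lintegral_congr fun r => ?_
  rw [← renewalIntegral_sum r (h := fun v => H (ENNReal.ofReal v)) (by fun_prop)]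
  refine renewalIntegral_congr fun z v hz hv => ?_
  simp only [ofReal_le_coe_iff]
  rw [← ENNReal.ofReal_sub _ hz, add_sub_cancel_left]

lemma lintegral_quadrupleIntensity_wait {H : ℝ≥0∞ → ℝ≥0∞ → ℝ≥0∞}
    (hH : Measurable fun x : ℝ≥0∞ × ℝ≥0∞ => H x.1 x.2) (t : ℝ≥0) :
    ∫⁻ u, (if u.2.2.2 ≤ (t : ℝ≥0∞) then H (u.2.1 - u.1) (u.2.2.2 - u.2.2.1) else 0)
        ∂quadrupleIntensity L =
      ∫⁻ r : ℝ≥0, (∫⁻ y : ℝ in Ioc 0 (t : ℝ), ∫⁻ v : ℝ in Ioc 0 (t - y), waitDensity r y *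
        (waitDensity r v * (ENNReal.ofReal (((r * (t - y - v) + 2) ^ 2 - 2) / 2) *
          H (ENNReal.ofReal y) (ENNReal.ofReal v)))) ∂L := by
  have hH' : Measurable fun u : ℝ≥0∞ × ℝ≥0∞ × ℝ≥0∞ × ℝ≥0∞ =>
      H (u.2.1 - u.1) (u.2.2.2 - u.2.2.1) :=
    hH.comp (by fun_prop : Measurable fun u : ℝ≥0∞ × ℝ≥0∞ × ℝ≥0∞ × ℝ≥0∞ =>
      (u.2.1 - u.1, u.2.2.2 - u.2.2.1))
  rw [lintegral_quadrupleIntensity (Measurable.ite (measurableSet_le (by fun_prop) (by fun_prop))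
    hH' (by fun_prop))]
  refine lintegral_congr fun r => ?_
  rw [← renewalIntegral_pair_sum r
    (H := fun y v => H (ENNReal.ofReal y) (ENNReal.ofReal v))
    (hH.comp (by fun_prop : Measurable fun x : ℝ × ℝ => (ENNReal.ofReal x.1, ENNReal.ofReal x.2)))]
  refine renewalIntegral_congr fun p y hp hy => renewalIntegral_congr fun z v hz hv => ?_
  simp only [ofReal_le_coe_iff]
  rw [← ENNReal.ofReal_sub _ hp, ← ENNReal.ofReal_sub _ (by linarith), add_sub_cancel_left,
    add_sub_cancel_left]

end AggregateClaims

end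

noncomputable section

namespace AggregateClaims

/-! ### Sums over the interclaim times -/

variable {Ω : Type*} [MeasurableSpace Ω] {P : Measure Ω} {T : ℕ → Ω → ℝ≥0∞} {L : Measure ℝ≥0}

lemma tsum_measure_preimage_singleton_inter {ι : Type*} [Countable ι] [MeasurableSpace ι]
    [MeasurableSingletonClass ι] {X : Ω → ι} (hX : AEMeasurable X P) {A : Set Ω}
    (hA : NullMeasurableSet A P) : ∑' i, P (X ⁻¹' {i} ∩ A) = P A := by
  rw [← measure_iUnion₀]
  · rw [← iUnion_inter, ← preimage_iUnion, iUnion_singleton_eq_range]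
    simp
  · intro i j hij
    refine (Set.disjoint_left.2 fun ω hi hj => hij ?_).aedisjoint
    exact (mem_singleton_iff.1 hi.1).symm.trans (mem_singleton_iff.1 hj.1)
  · exact fun i => (hX.nullMeasurable (measurableSet_singleton i)).inter hA

/-- On an ordered box at most one index contributes, namely `i = N(a)`. Splitting the gap event
according to the value of `N(a)` therefore gives the sum over `i`, and its probability is known from
the increments. -/
lemma IsClaimArrivalSequence.sum_map_consecutive [IsFiniteMeasure P]
    (hT : IsClaimArrivalSequence P T)
    (hN : IsMixedPoissonProcess P (claimNumber T) L) (t : ℝ≥0) :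
    (Measure.sum fun i => (P.restrict {ω | T (i + 1) ω ≤ t}).map
      fun ω => (T i ω, T (i + 1) ω)) =
      (consecutiveIntensity L).restrict {u | u.2 ≤ t} := by
  have hmT : ∀ i, Measurable (T i) := hT.measurable
  have hc := hT.aemeasurable_claimNumber
  have hp : ∀ i, Measurable fun ω => (T i ω, T (i + 1) ω) :=
    fun i => (hmT i).prodMk (hmT (i + 1))
  have hms : ∀ i, MeasurableSet {ω | T (i + 1) ω ≤ t} :=
    fun i => measurableSet_le (hmT _) measurable_const
  have hmb : ∀ a q b : ℝ≥0, MeasurableSet (Iic (a : ℝ≥0∞) ×ˢ Ioc (q : ℝ≥0∞) b) :=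
    fun a q b => measurableSet_Iic.prod measurableSet_Ioc
  have hbox : ∀ a q b : ℝ≥0, a ≤ q → q ≤ b → b ≤ t →
      (Measure.sum fun i => (P.restrict {ω | T (i + 1) ω ≤ t}).map
        fun ω => (T i ω, T (i + 1) ω)) (Iic (a : ℝ≥0∞) ×ˢ Ioc (q : ℝ≥0∞) b) =
      P {ω | claimNumber T q ω = claimNumber T a ω ∧ claimNumber T q ω < claimNumber T b ω} := by
    intro a q b haq hqb hbt
    rw [Measure.sum_apply _ (hmb a q b), ← tsum_measure_preimage_singleton_inter (hc a)]
    · refine tsum_congr fun i => ?_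
      rw [Measure.map_apply (hp i) (hmb a q b), Measure.restrict_apply (hp i (hmb a q b))]
      refine measure_congr ?_
      filter_upwards [hT.ae_le_iff, hT.ae_claimNumber_mono] with ω h hm
      refine propext ?_
      change (T i ω ≤ a ∧ q < T (i + 1) ω ∧ T (i + 1) ω ≤ b) ∧ T (i + 1) ω ≤ t ↔
        claimNumber T a ω = i ∧ _ ∧ _
      rw [← not_le, h, h, h, h]
      have := hm a q haq
      have := hm b t hbt
      omega
    · exact ((hc q).prodMk ((hc a).prodMk (hc b))).nullMeasurable
        (s := {x : ℕ × ℕ × ℕ | x.1 = x.2.1 ∧ x.1 < x.2.2}) MeasurableSet.of_discrete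
  refine ext_of_ordered_boxes t ?_ ?_ ?_ ?_
  · rw [Measure.ae_sum_iff]
    intro i
    have hm : MeasurableSet {x : ℝ≥0∞ × ℝ≥0∞ | x.1 < x.2 ∧ x.2 ≤ (t : ℝ≥0∞)} :=
      (measurableSet_lt measurable_fst measurable_snd).inter
        (measurableSet_le measurable_snd measurable_const)
    rw [ae_map_iff (hp i).aemeasurable hm, ae_restrict_iff' (hms i)]
    filter_upwards [hT.ae_lt_succ_of_ne_top] with ω h hω
    exact ⟨h i (hω.trans_lt ENNReal.coe_lt_top).ne, hω⟩
  · have hm : MeasurableSet {x : ℝ≥0∞ × ℝ≥0∞ | x.2 ≤ (t : ℝ≥0∞)} :=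
      measurableSet_le measurable_snd measurable_const
    rw [ae_restrict_iff' hm]
    filter_upwards [ae_consecutiveIntensity] with x h1 h2 using ⟨h1, h2⟩
  · intro a q b haq hqb hbt
    rw [hbox a q b haq hqb hbt, hN.measure_gap hc haq hqb, Measure.restrict_apply (hmb a q b),
      inter_eq_left.2, consecutiveIntensity_box haq hqb]
    rintro ⟨x1, x2⟩ hx
    exact hx.2.2.trans (by exact_mod_cast hbt)
  · intro a q b haq hqb hbt
    rw [hbox a q b haq hqb hbt]
    exact measure_ne_top _ _

/-- As for consecutive pairs, with the contributing indices `(i, j) = (N(a), N(c))`. -/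
lemma IsClaimArrivalSequence.sum_map_quadruple [IsFiniteMeasure P]
    (hT : IsClaimArrivalSequence P T)
    (hN : IsMixedPoissonProcess P (claimNumber T) L) (t : ℝ≥0) :
    (Measure.sum fun p : ℕ × ℕ => (P.restrict {ω | p.1 < p.2 ∧ T (p.2 + 1) ω ≤ t}).map
      fun ω => (T p.1 ω, T (p.1 + 1) ω, T p.2 ω, T (p.2 + 1) ω)) =
      (quadrupleIntensity L).restrict {u | u.2.2.2 ≤ t} := by
  have hmT : ∀ i, Measurable (T i) := hT.measurable
  have hc := hT.aemeasurable_claimNumber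
  have hp : ∀ p : ℕ × ℕ, Measurable fun ω => (T p.1 ω, T (p.1 + 1) ω, T p.2 ω, T (p.2 + 1) ω) :=
    fun p => (hmT _).prodMk ((hmT _).prodMk ((hmT _).prodMk (hmT _)))
  have hms : ∀ p : ℕ × ℕ, MeasurableSet {ω | p.1 < p.2 ∧ T (p.2 + 1) ω ≤ t} :=
    fun p => (MeasurableSet.const _).inter (measurableSet_le (hmT _) measurable_const)
  have hmb : ∀ a q b c r d : ℝ≥0, MeasurableSet (quadrupleBox a q b c r d) :=
    fun a q b c r d => measurableSet_Iic.prod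
      (measurableSet_Ioc.prod (measurableSet_Iic.prod measurableSet_Ioc))
  have hbox : ∀ a q b c r d : ℝ≥0, a ≤ q → q ≤ b → b ≤ c → c ≤ r → r ≤ d → d ≤ t →
      (Measure.sum fun p : ℕ × ℕ => (P.restrict {ω | p.1 < p.2 ∧ T (p.2 + 1) ω ≤ t}).map
        fun ω => (T p.1 ω, T (p.1 + 1) ω, T p.2 ω, T (p.2 + 1) ω))
        (quadrupleBox a q b c r d) =
      P {ω | (claimNumber T q ω = claimNumber T a ω ∧ claimNumber T q ω < claimNumber T b ω) ∧
        claimNumber T r ω = claimNumber T c ω ∧ claimNumber T r ω < claimNumber T d ω} := by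
    intro a q b c r d haq hqb hbc hcr hrd hdt
    rw [Measure.sum_apply _ (hmb a q b c r d),
      ← tsum_measure_preimage_singleton_inter ((hc a).prodMk (hc c))]
    · refine tsum_congr fun p => ?_
      rw [Measure.map_apply (hp p) (hmb a q b c r d),
        Measure.restrict_apply (hp p (hmb a q b c r d))]
      refine measure_congr ?_
      filter_upwards [hT.ae_le_iff, hT.ae_claimNumber_mono] with ω h hm
      refine propext ?_
      obtain ⟨i, j⟩ := p
      change (T i ω ≤ a ∧ (q < T (i + 1) ω ∧ T (i + 1) ω ≤ b) ∧
        T j ω ≤ c ∧ (r < T (j + 1) ω ∧ T (j + 1) ω ≤ d)) ∧ (i < j ∧ T (j + 1) ω ≤ t) ↔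
        (claimNumber T a ω, claimNumber T c ω) = (i, j) ∧ (_ ∧ _) ∧ _ ∧ _
      -- The condition `i < j` is automatic on the box: `i + 1 ≤ N(b) ≤ N(c) = j`.
      rw [← not_le, ← not_le, h, h, h, h, h, h, h, Prod.mk.injEq]
      have := hm a q haq
      have := hm b c hbc
      have := hm c r hcr
      have := hm d t hdt
      omega
    · exact ((hc q).prodMk ((hc a).prodMk ((hc b).prodMk ((hc r).prodMk
        ((hc c).prodMk (hc d)))))).nullMeasurable
        (s := {x : ℕ × ℕ × ℕ × ℕ × ℕ × ℕ | (x.1 = x.2.1 ∧ x.1 < x.2.2.1) ∧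
          x.2.2.2.1 = x.2.2.2.2.1 ∧ x.2.2.2.1 < x.2.2.2.2.2}) MeasurableSet.of_discrete
  refine ext_of_ordered_quadruple_boxes t ?_ ?_ ?_ ?_
  · rw [Measure.ae_sum_iff]
    intro p
    have hm : MeasurableSet {x | OrderedQuadruple t x} :=
      (measurableSet_lt measurable_fst measurable_snd.fst).inter
        ((measurableSet_le measurable_snd.fst measurable_snd.snd.fst).inter
          ((measurableSet_lt measurable_snd.snd.fst measurable_snd.snd.snd).inter
            (measurableSet_le measurable_snd.snd.snd measurable_const)))
    rw [ae_map_iff (hp p).aemeasurable hm, ae_restrict_iff' (hms p)]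
    filter_upwards [hT.ae_lt_succ_of_ne_top, hT.ae_monotone] with ω h hmono hω
    have h4 : T (p.2 + 1) ω ≠ ∞ := (hω.2.trans_lt ENNReal.coe_lt_top).ne
    have h3 := h p.2 h4
    have h2 : T (p.1 + 1) ω ≤ T p.2 ω := hmono hω.1
    exact ⟨h p.1 (h2.trans_lt (h3.trans h4.lt_top)).ne, h2, h3, hω.2⟩
  · have hm : MeasurableSet {x : ℝ≥0∞ × ℝ≥0∞ × ℝ≥0∞ × ℝ≥0∞ | x.2.2.2 ≤ (t : ℝ≥0∞)} :=
      measurableSet_le measurable_snd.snd.snd measurable_const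
    rw [ae_restrict_iff' hm]
    filter_upwards [ae_quadrupleIntensity] with x h1 h2 using ⟨h1.1, h1.2.1, h1.2.2, h2⟩
  · intro a q b c r d haq hqb hbc hcr hrd hdt
    rw [hbox a q b c r d haq hqb hbc hcr hrd hdt, hN.measure_gap_gap hc haq hqb hbc hcr hrd
      (hT.ae_claimNumber_mono.mono fun ω h => h b c hbc), Measure.restrict_apply (hmb a q b c r d),
      inter_eq_left.2, quadrupleIntensity_box haq hqb hbc hcr hrd]
    intro x hx
    exact hx.2.2.2.2.trans (by exact_mod_cast hdt)
  · intro a q b c r d haq hqb hbc hcr hrd hdt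
    rw [hbox a q b c r d haq hqb hbc hcr hrd hdt]
    exact measure_ne_top _ _

lemma interClaimTime_of_ne_top {Ω : Type*} {T : ℕ → Ω → ℝ≥0∞} {i : ℕ} {ω : Ω} (h : T (i + 1) ω ≠ ∞) :
    interClaimTime T i ω = T (i + 1) ω - T i ω := if_neg h

/-- Campbell's formula for the interclaim times of a mixed Poisson process. -/
lemma IsClaimArrivalSequence.tsum_lintegral_interClaimTime [IsFiniteMeasure P]
    (hT : IsClaimArrivalSequence P T)
    (hN : IsMixedPoissonProcess P (claimNumber T) L) (t : ℝ≥0) {H : ℝ≥0∞ → ℝ≥0∞}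
    (hH : Measurable H) :
    ∑' i, ∫⁻ ω in {ω | T (i + 1) ω ≤ t}, H (interClaimTime T i ω) ∂P =
      ∫⁻ r : ℝ≥0, (∫⁻ v : ℝ in Ioc 0 (t : ℝ), waitDensity r v *
        (ENNReal.ofReal (1 + r * (t - v)) * H (ENNReal.ofReal v))) ∂L := by
  have hms : ∀ i, MeasurableSet {ω | T (i + 1) ω ≤ t} :=
    fun i => measurableSet_le (hT.measurable _) measurable_const
  have hm : MeasurableSet {x : ℝ≥0∞ × ℝ≥0∞ | x.2 ≤ (t : ℝ≥0∞)} :=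
    measurableSet_le measurable_snd measurable_const
  have h := lintegral_indicator (μ := consecutiveIntensity L) hm fun u => H (u.2 - u.1)
  simp only [indicator_apply, mem_ofPred_eq] at h
  rw [← lintegral_consecutiveIntensity_wait hH t, h, ← hT.sum_map_consecutive hN t,
    lintegral_sum_measure]
  refine tsum_congr fun i => ?_
  rw [lintegral_map (by fun_prop) ((hT.measurable i).prodMk (hT.measurable (i + 1)))]
  refine setLIntegral_congr_fun (hms i) fun ω hω => ?_
  simp only
  rw [interClaimTime_of_ne_top (lt_of_le_of_lt hω ENNReal.coe_lt_top).ne]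

/-- Campbell's formula for the ordered pairs of interclaim times of a mixed Poisson process. -/
lemma IsClaimArrivalSequence.tsum_lintegral_interClaimTime_pair [IsFiniteMeasure P]
    (hT : IsClaimArrivalSequence P T)
    (hN : IsMixedPoissonProcess P (claimNumber T) L) (t : ℝ≥0) {H : ℝ≥0∞ → ℝ≥0∞ → ℝ≥0∞}
    (hH : Measurable fun x : ℝ≥0∞ × ℝ≥0∞ => H x.1 x.2) :
    ∑' p : ℕ × ℕ, ∫⁻ ω in {ω | p.1 < p.2 ∧ T (p.2 + 1) ω ≤ t},
        H (interClaimTime T p.1 ω) (interClaimTime T p.2 ω) ∂P =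
      ∫⁻ r : ℝ≥0, (∫⁻ y : ℝ in Ioc 0 (t : ℝ), ∫⁻ v : ℝ in Ioc 0 (t - y), waitDensity r y *
        (waitDensity r v * (ENNReal.ofReal (((r * (t - y - v) + 2) ^ 2 - 2) / 2) *
          H (ENNReal.ofReal y) (ENNReal.ofReal v)))) ∂L := by
  have hms : ∀ p : ℕ × ℕ, MeasurableSet {ω | p.1 < p.2 ∧ T (p.2 + 1) ω ≤ t} :=
    fun p => (MeasurableSet.const _).inter (measurableSet_le (hT.measurable _) measurable_const)
  have hm : MeasurableSet {x : ℝ≥0∞ × ℝ≥0∞ × ℝ≥0∞ × ℝ≥0∞ | x.2.2.2 ≤ (t : ℝ≥0∞)} :=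
    measurableSet_le measurable_snd.snd.snd measurable_const
  have h := lintegral_indicator (μ := quadrupleIntensity L) hm
    fun u => H (u.2.1 - u.1) (u.2.2.2 - u.2.2.1)
  simp only [indicator_apply, mem_ofPred_eq] at h
  rw [← lintegral_quadrupleIntensity_wait hH t, h, ← hT.sum_map_quadruple hN t,
    lintegral_sum_measure]
  refine tsum_congr fun p => ?_
  have hH' : Measurable fun u : ℝ≥0∞ × ℝ≥0∞ × ℝ≥0∞ × ℝ≥0∞ =>
      H (u.2.1 - u.1) (u.2.2.2 - u.2.2.1) :=
    hH.comp (by fun_prop : Measurable fun u : ℝ≥0∞ × ℝ≥0∞ × ℝ≥0∞ × ℝ≥0∞ =>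
      (u.2.1 - u.1, u.2.2.2 - u.2.2.1))
  rw [lintegral_map hH' ((hT.measurable _).prodMk ((hT.measurable _).prodMk
    ((hT.measurable _).prodMk (hT.measurable _))))]
  refine setLIntegral_congr_fun_ae (hms p) ?_
  filter_upwards [hT.ae_monotone] with ω hmono hω
  have h4 : T (p.2 + 1) ω ≠ ∞ := (lt_of_le_of_lt hω.2 ENNReal.coe_lt_top).ne
  have h2 : T (p.1 + 1) ω ≤ T (p.2 + 1) ω := hmono (by have := hω.1; omega)
  rw [interClaimTime_of_ne_top h4, interClaimTime_of_ne_top (h2.trans_lt h4.lt_top).ne]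

end AggregateClaims

end

noncomputable section

namespace AggregateClaims

/-! ### The conditional law of the claims given the arrival process -/

variable {Ω : Type*} [MeasurableSpace Ω] {P : Measure Ω} {T : ℕ → Ω → ℝ≥0∞} {X : ℕ → Ω → ℝ}

lemma measurable_interClaimTime (hT : ∀ i, Measurable (T i)) (i : ℕ) :
    Measurable (interClaimTime T i) :=
  Measurable.ite (hT (i + 1) (measurableSet_singleton _)) measurable_const
    ((hT (i + 1)).sub (hT i))

/-- The path of the arrival process. -/
def arrivalPath (T : ℕ → Ω → ℝ≥0∞) (ω : Ω) : ℕ → ℝ≥0∞ := fun i => T i ω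

lemma measurable_arrivalPath (hT : ∀ i, Measurable (T i)) : Measurable (arrivalPath T) :=
  measurable_pi_iff.2 hT

lemma measurable_interClaimTime_path (i : ℕ) :
    Measurable (interClaimTime (fun i (τ : ℕ → ℝ≥0∞) => τ i) i) :=
  measurable_interClaimTime measurable_pi_apply i

/-- The conditional law of `X i` given the path of the arrival process. -/
def claimKernel (P : Measure Ω) [IsFiniteMeasure P] (T : ℕ → Ω → ℝ≥0∞) (X : ℕ → Ω → ℝ) (i : ℕ) :
    Kernel (ℕ → ℝ≥0∞) ℝ :=
  (condDistrib (X i) (interClaimTime T i) P).comap _ (measurable_interClaimTime_path i)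

instance [IsFiniteMeasure P] (i : ℕ) : IsMarkovKernel (claimKernel P T X i) := by
  unfold claimKernel
  infer_instance

lemma claimKernel_arrivalPath [IsFiniteMeasure P] (i : ℕ) (ω : Ω) :
    claimKernel P T X i (arrivalPath T ω) =
      condDistrib (X i) (interClaimTime T i) P (interClaimTime T i ω) := rfl

lemma condExp_preimage_eq_claimKernel [IsFiniteMeasure P] (hT : ∀ i, Measurable (T i))
    (hX : ∀ i, Measurable (X i)) (hdep : DependOnlyOnInterClaimTimes P T X) (i : ℕ) {A : Set ℝ}
    (hA : MeasurableSet A) :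
    P⟦X i ⁻¹' A | arrivalSigma T⟧ =ᵐ[P]
      fun ω => (claimKernel P T X i (arrivalPath T ω)).real A :=
  (hdep i A hA).trans
    (condDistrib_ae_eq_condExp (measurable_interClaimTime hT i) (hX i) hA).symm

/-- Given the arrival process, `X i` and `X j` are independent with laws depending only on their
own interclaim times. -/
lemma map_arrivalPath_claims [IsFiniteMeasure P] (hT : ∀ i, Measurable (T i))
    (hX : ∀ i, Measurable (X i)) (hdep : DependOnlyOnInterClaimTimes P T X)
    (hind : CondIndepGivenArrivals P T X) {i j : ℕ} (hij : i ≠ j) :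
    P.map (fun ω => (arrivalPath T ω, X i ω, X j ω)) =
      (P.map (arrivalPath T)) ⊗ₘ (claimKernel P T X i ×ₖ claimKernel P T X j) := by
  have hp := measurable_arrivalPath hT
  refine Measure.ext_prod₃ fun {B A A'} hB hA hA' => ?_
  rw [Measure.map_apply (hp.prodMk ((hX i).prodMk (hX j))) (hB.prod (hA.prod hA')),
    Measure.compProd_apply_prod hB (hA.prod hA'), setLIntegral_map hB (Kernel.measurable_coe _
      (hA.prod hA')) hp]
  simp only [Kernel.prod_apply_prod]
  have hle : arrivalSigma T ≤ ‹MeasurableSpace Ω› := hp.comap_le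
  have hBm : MeasurableSet[arrivalSigma T] (arrivalPath T ⁻¹' B) := ⟨B, hB, rfl⟩
  have hcond : P⟦X i ⁻¹' A ∩ X j ⁻¹' A' | arrivalSigma T⟧ =ᵐ[P] fun ω =>
      (claimKernel P T X i (arrivalPath T ω)).real A *
        (claimKernel P T X j (arrivalPath T ω)).real A' := by
    have h := hind {i, j} (fun k => if k = i then A else A') (fun k _ => by
      split_ifs <;> assumption)
    have h1 : (⋂ k ∈ ({i, j} : Finset ℕ), X k ⁻¹' (if k = i then A else A')) =
        X i ⁻¹' A ∩ X j ⁻¹' A' := by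
      ext ω
      simp [hij.symm]
    rw [h1, Finset.prod_pair hij, if_pos rfl, if_neg hij.symm] at h
    filter_upwards [h, condExp_preimage_eq_claimKernel hT hX hdep i hA,
      condExp_preimage_eq_claimKernel hT hX hdep j hA'] with ω h1 h2 h3
    rw [h1, Pi.mul_apply, h2, h3]
  have hms : MeasurableSet (X i ⁻¹' A ∩ X j ⁻¹' A') := (hX i hA).inter (hX j hA')
  -- Conditional probabilities become probabilities of rectangles by integration over an event of
  -- the arrival sigma-algebra.
  have h2 : P.real (arrivalPath T ⁻¹' B ∩ (X i ⁻¹' A ∩ X j ⁻¹' A')) =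
      ∫ ω in arrivalPath T ⁻¹' B, (claimKernel P T X i (arrivalPath T ω)).real A *
        (claimKernel P T X j (arrivalPath T ω)).real A' ∂P := by
    rw [← setIntegral_congr_ae (hp hB) (hcond.mono fun ω h _ => h),
      setIntegral_condExp hle ((integrable_const 1).indicator hms) hBm,
      setIntegral_indicator hms]
    simp
  have hset : (fun ω => (arrivalPath T ω, X i ω, X j ω)) ⁻¹' (B ×ˢ A ×ˢ A') =
    arrivalPath T ⁻¹' B ∩ (X i ⁻¹' A ∩ X j ⁻¹' A') := rfl
  rw [hset, ← ofReal_measureReal, h2, ofReal_integral_eq_lintegral_ofReal]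
  · refine lintegral_congr fun ω => ?_
    rw [ENNReal.ofReal_mul measureReal_nonneg, ofReal_measureReal, ofReal_measureReal]
  · refine (integrable_condExp (m := arrivalSigma T)).congr hcond |>.integrableOn
  · exact ae_of_all _ fun ω => mul_nonneg measureReal_nonneg measureReal_nonneg

/-- Fubini for the disintegration of the joint law of path and claims, applied to `1_B φ ψ`; the
product kernel separates the two factors. -/
lemma setLIntegral_claim_mul_claim [IsFiniteMeasure P] (hT : ∀ i, Measurable (T i))
    (hX : ∀ i, Measurable (X i)) (hdep : DependOnlyOnInterClaimTimes P T X)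
    (hind : CondIndepGivenArrivals P T X) {i j : ℕ} (hij : i ≠ j) {φ ψ : ℝ → ℝ≥0∞} (hφ : Measurable φ)
    (hψ : Measurable ψ) {B : Set (ℕ → ℝ≥0∞)} (hB : MeasurableSet B) :
    ∫⁻ ω in arrivalPath T ⁻¹' B, φ (X i ω) * ψ (X j ω) ∂P =
      ∫⁻ ω in arrivalPath T ⁻¹' B,
        (∫⁻ x, φ x ∂condDistrib (X i) (interClaimTime T i) P (interClaimTime T i ω)) *
        (∫⁻ x, ψ x ∂condDistrib (X j) (interClaimTime T j) P (interClaimTime T j ω)) ∂P := by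
  have hp := measurable_arrivalPath hT
  have hm : Measurable fun y : (ℕ → ℝ≥0∞) × ℝ × ℝ =>
      B.indicator 1 y.1 * (φ y.2.1 * ψ y.2.2) :=
    Measurable.mul ((measurable_one.indicator hB).comp measurable_fst) (by fun_prop)
  have h := Measure.lintegral_compProd (μ := P.map (arrivalPath T))
    (κ := claimKernel P T X i ×ₖ claimKernel P T X j) hm
  rw [← map_arrivalPath_claims hT hX hdep hind hij,
    lintegral_map (Measurable.lintegral_kernel_prod_right' hm) hp,
    lintegral_map hm (hp.prodMk ((hX i).prodMk (hX j)))] at h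
  rw [← lintegral_indicator (hp hB), ← lintegral_indicator (hp hB)]
  convert h using 1
  · refine lintegral_congr fun ω => ?_
    by_cases hω : arrivalPath T ω ∈ B
    · simp [indicator_of_mem hω, indicator_of_mem (show ω ∈ arrivalPath T ⁻¹' B from hω)]
    · simp [indicator_of_notMem hω, indicator_of_notMem (show ω ∉ arrivalPath T ⁻¹' B from hω)]
  · refine lintegral_congr fun ω => ?_
    simp only
    rw [lintegral_const_mul _ (by fun_prop), Kernel.prod_apply,
      lintegral_prod_mul hφ.aemeasurable hψ.aemeasurable, claimKernel_arrivalPath,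
      claimKernel_arrivalPath]
    by_cases hω : arrivalPath T ω ∈ B
    · simp [indicator_of_mem hω, indicator_of_mem (show ω ∈ arrivalPath T ⁻¹' B from hω)]
    · simp [indicator_of_notMem hω, indicator_of_notMem (show ω ∉ arrivalPath T ⁻¹' B from hω)]

lemma setLIntegral_claim [IsFiniteMeasure P] (hT : ∀ i, Measurable (T i))
    (hX : ∀ i, Measurable (X i)) (hdep : DependOnlyOnInterClaimTimes P T X)
    (hind : CondIndepGivenArrivals P T X) (i : ℕ) {φ : ℝ → ℝ≥0∞} (hφ : Measurable φ)
    {B : Set (ℕ → ℝ≥0∞)} (hB : MeasurableSet B) :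
    ∫⁻ ω in arrivalPath T ⁻¹' B, φ (X i ω) ∂P =
      ∫⁻ ω in arrivalPath T ⁻¹' B,
        (∫⁻ x, φ x ∂condDistrib (X i) (interClaimTime T i) P (interClaimTime T i ω)) ∂P := by
  -- The partner claim carries the constant function `1`, so any index other than `i` would do.
  have h := setLIntegral_claim_mul_claim hT hX hdep hind (Nat.succ_ne_self i).symm hφ
    (measurable_const (a := (1 : ℝ≥0∞))) hB
  simpa using h

/-- The signed counterpart. Here integrability of the product has to be assumed, as it does not
follow from that of the product of conditional means. -/
lemma setIntegral_claim_mul_claim [IsFiniteMeasure P] (hT : ∀ i, Measurable (T i))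
    (hX : ∀ i, Measurable (X i)) (hdep : DependOnlyOnInterClaimTimes P T X)
    (hind : CondIndepGivenArrivals P T X) {i j : ℕ} (hij : i ≠ j) {B : Set (ℕ → ℝ≥0∞)}
    (hB : MeasurableSet B)
    (hint : IntegrableOn (fun ω => X i ω * X j ω) (arrivalPath T ⁻¹' B) P) :
    ∫ ω in arrivalPath T ⁻¹' B, X i ω * X j ω ∂P =
      ∫ ω in arrivalPath T ⁻¹' B,
        condMoment P 1 (X i) (interClaimTime T i) (interClaimTime T i ω) *
        condMoment P 1 (X j) (interClaimTime T j) (interClaimTime T j ω) ∂P := by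
  have hp := measurable_arrivalPath hT
  have hq := hp.prodMk ((hX i).prodMk (hX j))
  have hm : Measurable fun y : (ℕ → ℝ≥0∞) × ℝ × ℝ =>
      B.indicator (1 : (ℕ → ℝ≥0∞) → ℝ) y.1 * (y.2.1 * y.2.2) :=
    Measurable.mul ((measurable_one.indicator hB).comp measurable_fst) (by fun_prop)
  have heq : ∀ ω, B.indicator (1 : (ℕ → ℝ≥0∞) → ℝ) (arrivalPath T ω) * (X i ω * X j ω) =
      (arrivalPath T ⁻¹' B).indicator (fun ω => X i ω * X j ω) ω := by
    intro ω
    by_cases hω : arrivalPath T ω ∈ B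
    · simp [indicator_of_mem hω, indicator_of_mem (show ω ∈ arrivalPath T ⁻¹' B from hω)]
    · simp [indicator_of_notMem hω, indicator_of_notMem (show ω ∉ arrivalPath T ⁻¹' B from hω)]
  have hI : Integrable (fun y : (ℕ → ℝ≥0∞) × ℝ × ℝ =>
      B.indicator (1 : (ℕ → ℝ≥0∞) → ℝ) y.1 * (y.2.1 * y.2.2))
      (P.map (fun ω => (arrivalPath T ω, X i ω, X j ω))) := by
    rw [integrable_map_measure hm.aestronglyMeasurable hq.aemeasurable]
    refine ((integrable_indicator_iff (hp hB)).2 hint).congr (ae_of_all _ fun ω => ?_)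
    exact (heq ω).symm
  rw [map_arrivalPath_claims hT hX hdep hind hij] at hI
  have h := Measure.integral_compProd hI
  rw [← map_arrivalPath_claims hT hX hdep hind hij,
    integral_map hp.aemeasurable
      (StronglyMeasurable.integral_kernel_prod_right' hm.stronglyMeasurable).aestronglyMeasurable,
    integral_map hq.aemeasurable hm.aestronglyMeasurable] at h
  rw [← integral_indicator (hp hB), ← integral_indicator (hp hB)]
  convert h using 1
  · exact integral_congr_ae (ae_of_all _ fun ω => (heq ω).symm)
  · refine integral_congr_ae (ae_of_all _ fun ω => ?_)
    simp only
    rw [integral_const_mul, Kernel.prod_apply,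
      integral_prod_mul (fun x : ℝ => x) (fun x : ℝ => x), claimKernel_arrivalPath,
      claimKernel_arrivalPath]
    by_cases hω : arrivalPath T ω ∈ B
    · simp [indicator_of_mem hω, indicator_of_mem (show ω ∈ arrivalPath T ⁻¹' B from hω),
        condMoment]
    · simp [indicator_of_notMem hω, indicator_of_notMem (show ω ∉ arrivalPath T ⁻¹' B from hω)]

end AggregateClaims

end

noncomputable section

namespace AggregateClaims

variable {Ω : Type*} [MeasurableSpace Ω] {P : Measure Ω} {T : ℕ → Ω → ℝ≥0∞} {X : ℕ → Ω → ℝ}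

/-! ### Conditional moments integrated over events of the arrival process. -/

lemma measurable_condMoment [IsFiniteMeasure P] (k : ℕ) (Y : Ω → ℝ) (V : Ω → ℝ≥0∞) :
    Measurable (condMoment P k Y V) :=
  (StronglyMeasurable.integral_kernel (κ := condDistrib Y V P)
    (f := fun x : ℝ => x ^ k) (by fun_prop)).measurable

lemma SameCondMoments.ae_interClaimTime [IsFiniteMeasure P] (hmom : SameCondMoments P T X)
    (hT : ∀ i, Measurable (T i)) :
    ∀ᵐ ω ∂P, ∀ i, interClaimTime T i ω ≠ ∞ →
      Integrable (fun x : ℝ => x ^ 2)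
        (condDistrib (X i) (interClaimTime T i) P (interClaimTime T i ω)) ∧
      condMoment P 1 (X i) (interClaimTime T i) (interClaimTime T i ω) =
        condMoment P 1 (X 0) (interClaimTime T 0) (interClaimTime T i ω) ∧
      condMoment P 2 (X i) (interClaimTime T i) (interClaimTime T i ω) =
        condMoment P 2 (X 0) (interClaimTime T 0) (interClaimTime T i ω) := by
  rw [ae_all_iff]
  exact fun i => ae_of_ae_map (measurable_interClaimTime hT i).aemeasurable (hmom i)

lemma integrable_id_of_integrable_sq {μ : Measure ℝ} [IsFiniteMeasure μ]
    (h : Integrable (fun x : ℝ => x ^ 2) μ) : Integrable (fun x : ℝ => x) μ :=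
  ((memLp_two_iff_integrable_sq measurable_id.aestronglyMeasurable).2 h).integrable one_le_two

/-- The moment hypothesis speaks only of finite waiting times, which is why `B` must force `V i` to
be finite. In the application `B` bounds `T (i + 1)` by `t`. -/
lemma setLIntegral_claim_sq [IsFiniteMeasure P] (hT : ∀ i, Measurable (T i))
    (hX : ∀ i, Measurable (X i)) (hdep : DependOnlyOnInterClaimTimes P T X)
    (hind : CondIndepGivenArrivals P T X) (hmom : SameCondMoments P T X) (i : ℕ)
    {B : Set (ℕ → ℝ≥0∞)} (hB : MeasurableSet B)
    (hBi : ∀ᵐ ω ∂P, arrivalPath T ω ∈ B → interClaimTime T i ω ≠ ∞) :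
    ∫⁻ ω in arrivalPath T ⁻¹' B, ENNReal.ofReal (X i ω ^ 2) ∂P =
      ∫⁻ ω in arrivalPath T ⁻¹' B, ENNReal.ofReal
        (condMoment P 2 (X 0) (interClaimTime T 0) (interClaimTime T i ω)) ∂P := by
  rw [setLIntegral_claim hT hX hdep hind i (φ := fun x => ENNReal.ofReal (x ^ 2)) (by fun_prop) hB]
  refine setLIntegral_congr_fun_ae (measurable_arrivalPath hT hB) ?_
  filter_upwards [hBi, hmom.ae_interClaimTime hT] with ω h1 h2 hω
  obtain ⟨h3, -, h4⟩ := h2 i (h1 hω)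
  rw [← ofReal_integral_eq_lintegral_ofReal h3 (ae_of_all _ fun x => sq_nonneg x), ← h4]
  rfl

/-- Positivity passes from the joint law of `(V i, X i)` to almost every fibre of its
disintegration. It lets conditional means be computed as extended nonnegative integrals. -/
lemma ae_condDistrib_nonneg [IsFiniteMeasure P] (hT : ∀ i, Measurable (T i))
    (hX : ∀ i, Measurable (X i)) {i : ℕ} (h0 : 0 ≤ᵐ[P] X i) :
    ∀ᵐ ω ∂P, ∀ᵐ x ∂condDistrib (X i) (interClaimTime T i) P (interClaimTime T i ω), 0 ≤ x := by
  have hV := measurable_interClaimTime hT i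
  have hs : MeasurableSet {y : ℝ≥0∞ × ℝ | 0 ≤ y.2} := measurableSet_le (by fun_prop) (by fun_prop)
  have h : ∀ᵐ y ∂P.map (fun ω => (interClaimTime T i ω, X i ω)), 0 ≤ y.2 := by
    rw [ae_map_iff (hV.prodMk (hX i)).aemeasurable hs]
    exact h0
  rw [← compProd_map_condDistrib (hX i).aemeasurable, Measure.ae_compProd_iff hs] at h
  exact ae_of_ae_map hV.aemeasurable h

lemma setLIntegral_claim_mul_claim_of_nonneg [IsFiniteMeasure P] (hT : ∀ i, Measurable (T i))
    (hX : ∀ i, Measurable (X i)) (hdep : DependOnlyOnInterClaimTimes P T X)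
    (hind : CondIndepGivenArrivals P T X) (hmom : SameCondMoments P T X)
    (h0 : ∀ i, 0 ≤ᵐ[P] X i) {i j : ℕ} (hij : i ≠ j)
    {B : Set (ℕ → ℝ≥0∞)} (hB : MeasurableSet B)
    (hBi : ∀ᵐ ω ∂P, arrivalPath T ω ∈ B → interClaimTime T i ω ≠ ∞ ∧ interClaimTime T j ω ≠ ∞) :
    ∫⁻ ω in arrivalPath T ⁻¹' B, ENNReal.ofReal (2 * (X i ω * X j ω)) ∂P =
      ∫⁻ ω in arrivalPath T ⁻¹' B, ENNReal.ofReal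
        (2 * (condMoment P 1 (X 0) (interClaimTime T 0) (interClaimTime T i ω) *
          condMoment P 1 (X 0) (interClaimTime T 0) (interClaimTime T j ω))) ∂P := by
  have hm := measurable_arrivalPath hT hB
  have h1 : ∫⁻ ω in arrivalPath T ⁻¹' B, ENNReal.ofReal (2 * (X i ω * X j ω)) ∂P =
      ∫⁻ ω in arrivalPath T ⁻¹' B,
        (fun x => 2 * ENNReal.ofReal x) (X i ω) * ENNReal.ofReal (X j ω) ∂P := by
    refine setLIntegral_congr_fun_ae hm ?_
    filter_upwards [h0 i] with ω h _
    rw [ENNReal.ofReal_mul zero_le_two, ENNReal.ofReal_mul h, mul_assoc]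
    simp
  rw [h1, setLIntegral_claim_mul_claim hT hX hdep hind hij
    (φ := fun x => 2 * ENNReal.ofReal x) (by fun_prop) (by fun_prop) hB]
  refine setLIntegral_congr_fun_ae hm ?_
  filter_upwards [hBi, hmom.ae_interClaimTime hT, ae_condDistrib_nonneg hT hX (h0 i),
    ae_condDistrib_nonneg hT hX (h0 j)] with ω h1 h2 hi0 hj0 hω
  obtain ⟨hi1, hi2, -⟩ := h2 i (h1 hω).1
  obtain ⟨hj1, hj2, -⟩ := h2 j (h1 hω).2
  rw [lintegral_const_mul _ (by fun_prop),
    ← ofReal_integral_eq_lintegral_ofReal (integrable_id_of_integrable_sq hi1) hi0,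
    ← ofReal_integral_eq_lintegral_ofReal (integrable_id_of_integrable_sq hj1) hj0,
    ENNReal.ofReal_mul zero_le_two, ← hi2, ← hj2, ENNReal.ofReal_mul, mul_assoc]
  · simp [condMoment]
  · simp only [condMoment, pow_one]
    exact integral_nonneg_of_ae hi0

lemma integrableOn_claim_sq [IsFiniteMeasure P] (hT : ∀ i, Measurable (T i))
    (hX : ∀ i, Measurable (X i)) (hdep : DependOnlyOnInterClaimTimes P T X)
    (hind : CondIndepGivenArrivals P T X) (hmom : SameCondMoments P T X) (i : ℕ)
    {B : Set (ℕ → ℝ≥0∞)} (hB : MeasurableSet B)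
    (hBi : ∀ᵐ ω ∂P, arrivalPath T ω ∈ B → interClaimTime T i ω ≠ ∞)
    (hfin : ∫⁻ ω in arrivalPath T ⁻¹' B, ENNReal.ofReal
        (condMoment P 2 (X 0) (interClaimTime T 0) (interClaimTime T i ω)) ∂P ≠ ∞) :
    IntegrableOn (fun ω => X i ω ^ 2) (arrivalPath T ⁻¹' B) P := by
  refine (lintegral_ofReal_ne_top_iff_integrable ((hX i).pow_const 2).aestronglyMeasurable
    (ae_of_all _ fun ω => sq_nonneg _)).1 ?_
  rwa [setLIntegral_claim_sq hT hX hdep hind hmom i hB hBi]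

lemma setIntegral_claim_sq [IsFiniteMeasure P] (hT : ∀ i, Measurable (T i))
    (hX : ∀ i, Measurable (X i)) (hdep : DependOnlyOnInterClaimTimes P T X)
    (hind : CondIndepGivenArrivals P T X) (hmom : SameCondMoments P T X) (i : ℕ)
    {B : Set (ℕ → ℝ≥0∞)} (hB : MeasurableSet B)
    (hBi : ∀ᵐ ω ∂P, arrivalPath T ω ∈ B → interClaimTime T i ω ≠ ∞) :
    ∫ ω in arrivalPath T ⁻¹' B, X i ω ^ 2 ∂P =
      ∫ ω in arrivalPath T ⁻¹' B,
        condMoment P 2 (X 0) (interClaimTime T 0) (interClaimTime T i ω) ∂P := by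
  have hm := measurable_arrivalPath hT hB
  rw [integral_eq_lintegral_of_nonneg_ae (ae_of_all _ fun ω => sq_nonneg _)
    ((hX i).pow_const 2).aestronglyMeasurable,
    setLIntegral_claim_sq hT hX hdep hind hmom i hB hBi, ← integral_eq_lintegral_of_nonneg_ae]
  · refine (ae_restrict_iff' hm).2 ?_
    filter_upwards [hBi, hmom.ae_interClaimTime hT] with ω h1 h2 hω
    rw [← (h2 i (h1 hω)).2.2]
    exact integral_nonneg fun x => sq_nonneg x
  · exact ((measurable_condMoment 2 (X 0) (interClaimTime T 0)).comp
      (measurable_interClaimTime hT i)).aestronglyMeasurable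

lemma setIntegral_claim_mul_claim_eq_moments [IsFiniteMeasure P] (hT : ∀ i, Measurable (T i))
    (hX : ∀ i, Measurable (X i)) (hdep : DependOnlyOnInterClaimTimes P T X)
    (hind : CondIndepGivenArrivals P T X) (hmom : SameCondMoments P T X) {i j : ℕ} (hij : i ≠ j)
    {B : Set (ℕ → ℝ≥0∞)} (hB : MeasurableSet B)
    (hBi : ∀ᵐ ω ∂P, arrivalPath T ω ∈ B → interClaimTime T i ω ≠ ∞ ∧ interClaimTime T j ω ≠ ∞)
    (hint : IntegrableOn (fun ω => X i ω * X j ω) (arrivalPath T ⁻¹' B) P) :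
    ∫ ω in arrivalPath T ⁻¹' B, X i ω * X j ω ∂P =
      ∫ ω in arrivalPath T ⁻¹' B,
        condMoment P 1 (X 0) (interClaimTime T 0) (interClaimTime T i ω) *
          condMoment P 1 (X 0) (interClaimTime T 0) (interClaimTime T j ω) ∂P := by
  rw [setIntegral_claim_mul_claim hT hX hdep hind hij hB hint]
  refine setIntegral_congr_ae (measurable_arrivalPath hT hB) ?_
  filter_upwards [hBi, hmom.ae_interClaimTime hT] with ω h1 h2 hω
  rw [(h2 i (h1 hω).1).2.1, (h2 j (h1 hω).2).2.1]

/-! ### Sums with randomly many terms -/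

lemma sq_sum_range (x : ℕ → ℝ) (n : ℕ) :
    (∑ i ∈ Finset.range n, x i) ^ 2 = ∑ i ∈ Finset.range n, x i ^ 2 +
      ∑ p ∈ (Finset.range n ×ˢ Finset.range n).filter (fun p => p.1 < p.2),
        2 * (x p.1 * x p.2) := by
  rw [Finset.sum_filter, Finset.sum_product, sq, Finset.sum_mul_sum]
  have h : ∀ i j : ℕ, x i * x j = (if j = i then x i ^ 2 else 0) +
      ((if i < j then x i * x j else 0) + if j < i then x j * x i else 0) := by
    intro i j
    rcases lt_trichotomy i j with h | rfl | h
    · simp [h, h.ne', h.not_gt]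
    · simp [sq]
    · simp [h, h.ne, h.not_gt, mul_comm]
  rw [Finset.sum_congr rfl fun i _ => Finset.sum_congr rfl fun j _ => h i j]
  simp only [Finset.sum_add_distrib]
  have h1 : ∑ i ∈ Finset.range n, ∑ j ∈ Finset.range n, (if j < i then x j * x i else 0) =
      ∑ i ∈ Finset.range n, ∑ j ∈ Finset.range n, if i < j then x i * x j else 0 :=
    Finset.sum_comm
  rw [h1, ← two_mul, Finset.mul_sum]
  congr 1
  · refine Finset.sum_congr rfl fun i hi => ?_
    rw [Finset.sum_ite_eq' _ _, if_pos hi]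
  · refine Finset.sum_congr rfl fun i hi => ?_
    rw [Finset.mul_sum]
    refine Finset.sum_congr rfl fun j hj => ?_
    rw [mul_ite, mul_zero]

/-- The integral of a sum with randomly many terms. -/
lemma integrable_of_eq_tsum_indicator {ι : Type*} [Countable ι] {D : ι → Set Ω}
    (hD : ∀ i, MeasurableSet (D i)) {f : ι → Ω → ℝ} (hf : ∀ i, Measurable (f i))
    (hfin : ∑' i, ∫⁻ ω in D i, ENNReal.ofReal |f i ω| ∂P ≠ ∞) {F : Ω → ℝ}
    (hF : ∀ᵐ ω ∂P, F ω = ∑' i, (D i).indicator (f i) ω) :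
    Integrable F P ∧ ∫ ω, F ω ∂P =
      (∑' i, ∫⁻ ω in D i, ENNReal.ofReal (f i ω) ∂P).toReal -
        (∑' i, ∫⁻ ω in D i, ENNReal.ofReal (-f i ω) ∂P).toReal := by
  have hsum : ∀ g : ι → Ω → ℝ, (∀ i, Measurable (g i)) →
      ∫⁻ ω, ∑' i, (D i).indicator (fun ω => ENNReal.ofReal (g i ω)) ω ∂P =
      ∑' i, ∫⁻ ω in D i, ENNReal.ofReal (g i ω) ∂P := by
    intro g hg
    rw [lintegral_tsum fun i => ((hg i).ennreal_ofReal.indicator (hD i)).aemeasurable]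
    exact tsum_congr fun i => lintegral_indicator (hD i) _
  have hle : ∀ g : ι → Ω → ℝ, (∀ i ω, g i ω ≤ |f i ω|) →
      ∑' i, ∫⁻ ω in D i, ENNReal.ofReal (g i ω) ∂P ≠ ∞ := fun g hg =>
    ne_top_of_le_ne_top hfin (ENNReal.tsum_le_tsum fun i => lintegral_mono fun ω =>
      ENNReal.ofReal_le_ofReal (hg i ω))
  have hp := hle f fun i ω => le_abs_self _
  have hn := hle (fun i ω => -f i ω) fun i ω => neg_le_abs _
  rw [← hsum f hf] at hp ⊢
  rw [← hsum (fun i ω => -f i ω) fun i => (hf i).neg] at hn ⊢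
  have hmeas : ∀ g : ι → Ω → ℝ, (∀ i, Measurable (g i)) → AEMeasurable
      (fun ω => ∑' i, (D i).indicator (fun ω => ENNReal.ofReal (g i ω)) ω) P := fun g hg =>
    (Measurable.tsum fun i => (hg i).ennreal_ofReal.indicator (hD i)).aemeasurable
  have hpm := hmeas f hf
  have hnm := hmeas (fun i ω => -f i ω) fun i => (hf i).neg
  have hpi := integrable_toReal_of_lintegral_ne_top hpm hp
  have hni := integrable_toReal_of_lintegral_ne_top hnm hn
  have hpt := ae_lt_top' hpm hp
  have hnt := ae_lt_top' hnm hn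
  have hFe : F =ᵐ[P] fun ω =>
      (∑' i, (D i).indicator (fun ω => ENNReal.ofReal (f i ω)) ω).toReal -
      (∑' i, (D i).indicator (fun ω => ENNReal.ofReal (-f i ω)) ω).toReal := by
    filter_upwards [hF, hpt, hnt] with ω h1 h2 h3
    -- Almost surely both the positive and the negative parts have finite sums, so the series may be
    -- split.
    rw [h1, ENNReal.tsum_toReal_eq (ENNReal.ne_top_of_tsum_ne_top h2.ne),
      ENNReal.tsum_toReal_eq (ENNReal.ne_top_of_tsum_ne_top h3.ne),
      ← (ENNReal.summable_toReal h2.ne).tsum_sub (ENNReal.summable_toReal h3.ne)]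
    refine tsum_congr fun i => ?_
    by_cases hi : ω ∈ D i
    · simp only [indicator_of_mem hi, ENNReal.toReal_ofReal']
      rcases le_total 0 (f i ω) with h | h
      · rw [max_eq_left h, max_eq_right (by linarith)]; ring
      · rw [max_eq_right h, max_eq_left (by linarith)]; ring
    · simp [indicator_of_notMem hi]
  refine ⟨(hpi.sub hni).congr hFe.symm, ?_⟩
  rw [integral_congr_ae hFe, integral_sub hpi hni, integral_toReal hpm hpt, integral_toReal hnm hnt]

/-- A nonnegative function which has the same integrals as an integrable function over the pieces
of a countable partition is integrable, with the same integral. -/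
lemma integrable_of_setIntegral_eq {ι : Type*} [Countable ι] {E : ι → Set Ω}
    (hE : ∀ i, MeasurableSet (E i)) (hd : Pairwise fun i j => AEDisjoint P (E i) (E j))
    (hcov : ∀ᵐ ω ∂P, ω ∈ ⋃ i, E i) {f g : Ω → ℝ}
    (hf0 : ∀ ω, 0 ≤ f ω) (hg : Integrable g P) (hfi : ∀ i, IntegrableOn f (E i) P)
    (h : ∀ i, ∫ ω in E i, f ω ∂P = ∫ ω in E i, g ω ∂P) :
    Integrable f P ∧ ∫ ω, f ω ∂P = ∫ ω, g ω ∂P := by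
  have hn : ∀ i, NullMeasurableSet (E i) P := fun i => (hE i).nullMeasurableSet
  have hr : P.restrict (⋃ i, E i) = P := Measure.restrict_eq_self_of_ae_mem hcov
  have hf : AEStronglyMeasurable f P := by
    rw [← hr, aestronglyMeasurable_iUnion_iff]
    exact fun i => (hfi i).aestronglyMeasurable
  have hint : Integrable f P := by
    refine (lintegral_ofReal_ne_top_iff_integrable hf (ae_of_all _ hf0)).1 ?_
    rw [← hr, lintegral_iUnion₀ hn hd]
    refine ne_top_of_le_ne_top (b := ∑' i, ∫⁻ ω in E i, ‖g ω‖ₑ ∂P) ?_ ?_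
    · rw [← lintegral_iUnion₀ hn hd, hr]
      exact hg.2.ne
    -- On each piece `∫ f = ∫ g ≤ ∫ |g|`. Since `f ≥ 0`, summation bounds its whole integral by that
    -- of `|g|`.
    · refine ENNReal.tsum_le_tsum fun i => ?_
      rw [← ofReal_integral_eq_lintegral_ofReal (hfi i) (ae_of_all _ hf0), h i]
      refine le_trans ?_ (enorm_integral_le_lintegral_enorm _)
      rw [← ofReal_norm]
      exact ENNReal.ofReal_le_ofReal (le_abs_self _)
  refine ⟨hint, ?_⟩
  rw [← hr, integral_iUnion_ae hn hd hint.integrableOn, integral_iUnion_ae hn hd hg.integrableOn]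
  exact tsum_congr h

end AggregateClaims

end

noncomputable section

namespace AggregateClaims

/-! ### The integrals of the renewal formula -/

section Reference

variable {L : Measure ℝ≥0}

/-- The Campbell formulas live in `[0, ∞]`. Writing each signed integral as a difference of two
extended nonnegative ones allows them to be applied to positive and negative parts separately. -/
lemma integral_eq_sub_of_lintegral_abs {α : Type*} [MeasurableSpace α] {μ : Measure α} {f : α → ℝ}
    (hf : Measurable f) (hfin : ∫⁻ x, ENNReal.ofReal |f x| ∂μ ≠ ∞) :
    Integrable f μ ∧ ∫ x, f x ∂μ =
      (∫⁻ x, ENNReal.ofReal (f x) ∂μ).toReal - (∫⁻ x, ENNReal.ofReal (-f x) ∂μ).toReal := by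
  have h : Integrable f μ := ⟨hf.aestronglyMeasurable, by
    simpa only [HasFiniteIntegral, ← ofReal_norm, Real.norm_eq_abs] using hfin.lt_top⟩
  exact ⟨h, integral_eq_lintegral_pos_part_sub_lintegral_neg_part h⟩

lemma iterated_integral_eq_sub [SFinite L] {f : ℝ≥0 × ℝ → ℝ} (hf : Measurable f) {t : ℝ}
    (ht : 0 ≤ t)
    (hfin : ∫⁻ r : ℝ≥0, (∫⁻ v : ℝ in Ioc 0 t, ENNReal.ofReal |f (r, v)|) ∂L ≠ ∞) :
    ∫ r : ℝ≥0, (∫ v in (0 : ℝ)..t, f (r, v)) ∂L =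
      (∫⁻ r : ℝ≥0, (∫⁻ v : ℝ in Ioc 0 t, ENNReal.ofReal (f (r, v))) ∂L).toReal -
        (∫⁻ r : ℝ≥0, (∫⁻ v : ℝ in Ioc 0 t, ENNReal.ofReal (-f (r, v))) ∂L).toReal := by
  have hl : ∀ g : ℝ≥0 × ℝ → ℝ, Measurable g →
      ∫⁻ x, ENNReal.ofReal (g x) ∂(L.prod (volume.restrict (Ioc 0 t))) =
      ∫⁻ r : ℝ≥0, (∫⁻ v : ℝ in Ioc 0 t, ENNReal.ofReal (g (r, v))) ∂L :=
    fun g hg => lintegral_prod _ (by fun_prop)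
  rw [← hl _ hf.abs] at hfin
  obtain ⟨h1, h2⟩ := integral_eq_sub_of_lintegral_abs hf hfin
  rw [hl _ hf, hl (fun x => -f x) hf.neg, integral_prod _ h1] at h2
  rw [← h2]
  simp_rw [intervalIntegral.integral_of_le ht]

lemma iterated_integral_pair_eq_sub [SFinite L] {f : ℝ≥0 × ℝ × ℝ → ℝ} (hf : Measurable f) {t : ℝ}
    (ht : 0 ≤ t)
    (hfin : ∫⁻ r : ℝ≥0, (∫⁻ y : ℝ in Ioc 0 t, ∫⁻ v : ℝ in Ioc 0 (t - y),
      ENNReal.ofReal |f (r, y, v)|) ∂L ≠ ∞) :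
    ∫ r : ℝ≥0, (∫ y in (0 : ℝ)..t, ∫ v in (0 : ℝ)..(t - y), f (r, y, v)) ∂L =
      (∫⁻ r : ℝ≥0, (∫⁻ y : ℝ in Ioc 0 t, ∫⁻ v : ℝ in Ioc 0 (t - y),
        ENNReal.ofReal (f (r, y, v))) ∂L).toReal -
      (∫⁻ r : ℝ≥0, (∫⁻ y : ℝ in Ioc 0 t, ∫⁻ v : ℝ in Ioc 0 (t - y),
        ENNReal.ofReal (-f (r, y, v))) ∂L).toReal := by
  -- The limit `t - y` of the inner integral varies with `y`; it is moved into an indicator so that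
  -- Fubini applies to a genuine product measure.
  let R : Set (ℝ≥0 × ℝ × ℝ) := {x | 0 < x.2.2 ∧ x.2.2 ≤ t - x.2.1}
  have hR : MeasurableSet R := by
    have h1 : MeasurableSet {x : ℝ≥0 × ℝ × ℝ | 0 < x.2.2} :=
      measurableSet_lt (by fun_prop) (by fun_prop)
    have h2 : MeasurableSet {x : ℝ≥0 × ℝ × ℝ | x.2.2 ≤ t - x.2.1} :=
      measurableSet_le (by fun_prop) (by fun_prop)
    exact h1.inter h2
  let μ := L.prod ((volume.restrict (Ioc 0 t)).prod (volume : Measure ℝ))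
  have hl : ∀ g : ℝ≥0 × ℝ × ℝ → ℝ, Measurable g →
      ∫⁻ x, ENNReal.ofReal (R.indicator g x) ∂μ =
      ∫⁻ r : ℝ≥0, (∫⁻ y : ℝ in Ioc 0 t, ∫⁻ v : ℝ in Ioc 0 (t - y),
        ENNReal.ofReal (g (r, y, v))) ∂L := by
    intro g hg
    have hg' : Measurable fun x => ENNReal.ofReal (R.indicator g x) :=
      (hg.indicator hR).ennreal_ofReal
    rw [lintegral_prod _ hg'.aemeasurable]
    refine lintegral_congr fun r => ?_
    have hg'' : Measurable fun x : ℝ × ℝ => ENNReal.ofReal (R.indicator g (r, x)) :=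
      hg'.comp (by fun_prop : Measurable fun x : ℝ × ℝ => (r, x))
    rw [lintegral_prod _ hg''.aemeasurable]
    refine lintegral_congr fun y => ?_
    rw [← lintegral_indicator measurableSet_Ioc]
    refine lintegral_congr fun v => ?_
    by_cases hv : v ∈ Ioc 0 (t - y)
    · rw [indicator_of_mem hv, indicator_of_mem (show (r, y, v) ∈ R from hv)]
    · rw [indicator_of_notMem hv, indicator_of_notMem (show (r, y, v) ∉ R from hv),
        ENNReal.ofReal_zero]
  have habs : ∀ x, |R.indicator f x| = R.indicator (fun x => |f x|) x := by
    intro x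
    by_cases hx : x ∈ R
    · simp [indicator_of_mem hx]
    · simp [indicator_of_notMem hx]
  have hneg : ∀ x, -R.indicator f x = R.indicator (fun x => -f x) x := by
    intro x
    by_cases hx : x ∈ R
    · simp [indicator_of_mem hx]
    · simp [indicator_of_notMem hx]
  rw [← hl _ hf.abs] at hfin
  simp_rw [← habs] at hfin
  obtain ⟨h1, h2⟩ := integral_eq_sub_of_lintegral_abs (hf.indicator hR) hfin
  simp_rw [hneg] at h2
  rw [hl _ hf, hl (fun x => -f x) hf.neg, integral_prod _ h1] at h2
  rw [← h2]
  refine integral_congr_ae ?_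
  filter_upwards [h1.prod_right_ae] with r hr
  rw [integral_prod _ hr, intervalIntegral.integral_of_le ht]
  refine setIntegral_congr_fun measurableSet_Ioc fun y hy => ?_
  rw [intervalIntegral.integral_of_le (sub_nonneg.2 hy.2), ← integral_indicator measurableSet_Ioc]
  refine integral_congr_ae (ae_of_all _ fun v => ?_)
  by_cases hv : v ∈ Ioc 0 (t - y)
  · simp only [indicator_of_mem hv, indicator_of_mem (show (r, y, v) ∈ R from hv)]
  · simp only [indicator_of_notMem hv, indicator_of_notMem (show (r, y, v) ∉ R from hv)]

/-! ### Matching the integrands with the renewal densities. -/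

lemma measurable_singleIntegrand {Θ : ℝ≥0∞ → ℝ} (hΘ : Measurable Θ) (t : ℝ) :
    Measurable fun x : ℝ≥0 × ℝ => singleIntegrand Θ t x.1 x.2 := by
  unfold singleIntegrand
  fun_prop

lemma measurable_pairIntegrand {Δ : ℝ≥0∞ → ℝ} (hΔ : Measurable Δ) (t : ℝ) :
    Measurable fun x : ℝ≥0 × ℝ × ℝ => pairIntegrand Δ t x.1 x.2.1 x.2.2 := by
  unfold pairIntegrand
  fun_prop

lemma waitDensity_mul_linear (r : ℝ≥0) {t v : ℝ} (hv : v ≤ t) (θ : ℝ) :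
    waitDensity r v * (ENNReal.ofReal (1 + r * (t - v)) * ENNReal.ofReal θ) =
      ENNReal.ofReal (r * Real.exp (-(r * v)) * (r * (t - v) + 1) * θ) := by
  have h1 : (0 : ℝ) ≤ r * (t - v) := mul_nonneg r.coe_nonneg (sub_nonneg.2 hv)
  have h2 : (0 : ℝ) ≤ r * Real.exp (-(r * v)) := mul_nonneg r.coe_nonneg (Real.exp_nonneg _)
  rw [waitDensity, ← mul_assoc, ← ENNReal.ofReal_mul h2, add_comm,
    ← ENNReal.ofReal_mul (mul_nonneg h2 (by linarith))]

/-- The factor of `Δ(y) Δ(v)` in the integrand for the pairs of claims. -/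
def pairWeight (t r y v : ℝ) : ℝ :=
  r ^ 2 * Real.exp (-(r * (y + v))) * ((r * (t - y - v) + 2) ^ 2 - 2)

lemma pairIntegrand_eq (Δ : ℝ≥0∞ → ℝ) (t r y v : ℝ) : pairIntegrand Δ t r y v =
    pairWeight t r y v * (Δ (ENNReal.ofReal y) * Δ (ENNReal.ofReal v)) := by
  unfold pairIntegrand pairWeight
  ring

lemma pairWeight_nonneg (r : ℝ≥0) {t y v : ℝ} (hv : v ≤ t - y) : 0 ≤ pairWeight t r y v := by
  have h1 : (0 : ℝ) ≤ r * (t - y - v) := mul_nonneg r.coe_nonneg (sub_nonneg.2 hv)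
  refine mul_nonneg (mul_nonneg (sq_nonneg _) (Real.exp_nonneg _)) ?_
  nlinarith

/-- The `2` of the off-diagonal terms cancels the `1 / 2` of the renewal weight. The constraint `v ≤
t - y` keeps the weight nonnegative, so that `ENNReal.ofReal` is multiplicative. -/
lemma waitDensity_mul_quadratic (r : ℝ≥0) {t y v : ℝ} (hv : v ≤ t - y) (h : ℝ) :
    waitDensity r y * (waitDensity r v * (ENNReal.ofReal (((r * (t - y - v) + 2) ^ 2 - 2) / 2) *
      ENNReal.ofReal (2 * h))) = ENNReal.ofReal (pairWeight t r y v * h) := by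
  have h1 : (0 : ℝ) ≤ r * (t - y - v) := mul_nonneg r.coe_nonneg (sub_nonneg.2 hv)
  have h2 : ∀ v : ℝ, (0 : ℝ) ≤ r * Real.exp (-(r * v)) :=
    fun v => mul_nonneg r.coe_nonneg (Real.exp_nonneg _)
  have h3 : (0 : ℝ) ≤ ((r * (t - y - v) + 2) ^ 2 - 2) / 2 := by nlinarith
  rw [waitDensity, waitDensity, ← ENNReal.ofReal_mul h3, ← ENNReal.ofReal_mul (h2 _),
    ← ENNReal.ofReal_mul (h2 _)]
  congr 1
  unfold pairWeight
  rw [mul_add, neg_add, Real.exp_add]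
  ring

end Reference

variable {Ω : Type*} [MeasurableSpace Ω] {P : Measure Ω} {T : ℕ → Ω → ℝ≥0∞} {L : Measure ℝ≥0}

lemma IsClaimArrivalSequence.tsum_lintegral_single [IsFiniteMeasure P]
    (hT : IsClaimArrivalSequence P T)
    (hN : IsMixedPoissonProcess P (claimNumber T) L) (t : ℝ≥0) {θ : ℝ≥0∞ → ℝ}
    (hθ : Measurable θ) :
    ∑' i, ∫⁻ ω in {ω | T (i + 1) ω ≤ t}, ENNReal.ofReal (θ (interClaimTime T i ω)) ∂P =
      ∫⁻ r : ℝ≥0, (∫⁻ v : ℝ in Ioc 0 (t : ℝ), ENNReal.ofReal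
        (r * Real.exp (-(r * v)) * (r * (t - v) + 1) * θ (ENNReal.ofReal v))) ∂L := by
  rw [hT.tsum_lintegral_interClaimTime hN t (H := fun v => ENNReal.ofReal (θ v)) (by fun_prop)]
  refine lintegral_congr fun r => setLIntegral_congr_fun measurableSet_Ioc fun v hv => ?_
  exact waitDensity_mul_linear r hv.2 _

lemma IsClaimArrivalSequence.tsum_lintegral_pair [IsFiniteMeasure P]
    (hT : IsClaimArrivalSequence P T)
    (hN : IsMixedPoissonProcess P (claimNumber T) L) (t : ℝ≥0) {h : ℝ≥0∞ → ℝ≥0∞ → ℝ}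
    (hh : Measurable fun x : ℝ≥0∞ × ℝ≥0∞ => h x.1 x.2) :
    ∑' p : ℕ × ℕ, ∫⁻ ω in {ω | p.1 < p.2 ∧ T (p.2 + 1) ω ≤ t},
        ENNReal.ofReal (2 * h (interClaimTime T p.1 ω) (interClaimTime T p.2 ω)) ∂P =
      ∫⁻ r : ℝ≥0, (∫⁻ y : ℝ in Ioc 0 (t : ℝ), ∫⁻ v : ℝ in Ioc 0 (t - y), ENNReal.ofReal
        (pairWeight t r y v * h (ENNReal.ofReal y) (ENNReal.ofReal v))) ∂L := by
  rw [hT.tsum_lintegral_interClaimTime_pair hN t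
    (H := fun y v => ENNReal.ofReal (2 * h y v)) (by fun_prop)]
  refine lintegral_congr fun r => setLIntegral_congr_fun measurableSet_Ioc fun y hy =>
    setLIntegral_congr_fun measurableSet_Ioc fun v hv => ?_
  exact waitDensity_mul_quadratic r hv.2 _

end AggregateClaims

end

noncomputable section

namespace AggregateClaims

/-! ### The second moment of the aggregate claim -/

lemma tsum_indicator_arrival {Ω M : Type*} {T : ℕ → Ω → ℝ≥0∞} [AddCommMonoid M]
    [TopologicalSpace M] [T2Space M] {t : ℝ≥0} {n : ℕ} {ω : Ω} (h : ∀ i, T i ω ≤ t ↔ i ≤ n)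
    (f : ℕ → Ω → M) :
    ∑' i, {ω | T (i + 1) ω ≤ t}.indicator (f i) ω = ∑ i ∈ Finset.range n, f i ω := by
  rw [tsum_eq_sum (s := Finset.range n)]
  · refine Finset.sum_congr rfl fun i hi => indicator_of_mem ?_ _
    exact (h _).2 (Finset.mem_range.1 hi)
  · intro i hi
    refine indicator_of_notMem (fun hmem => hi ?_) _
    exact Finset.mem_range.2 ((h _).1 hmem)

lemma tsum_indicator_arrival_pair {Ω M : Type*} {T : ℕ → Ω → ℝ≥0∞} [AddCommMonoid M]
    [TopologicalSpace M] [T2Space M] {t : ℝ≥0} {n : ℕ} {ω : Ω} (h : ∀ i, T i ω ≤ t ↔ i ≤ n)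
    (f : ℕ × ℕ → Ω → M) :
    ∑' p : ℕ × ℕ, {ω | p.1 < p.2 ∧ T (p.2 + 1) ω ≤ t}.indicator (f p) ω =
      ∑ p ∈ (Finset.range n ×ˢ Finset.range n).filter (fun p => p.1 < p.2), f p ω := by
  rw [tsum_eq_sum (s := (Finset.range n ×ˢ Finset.range n).filter (fun p => p.1 < p.2))]
  · refine Finset.sum_congr rfl fun p hp => indicator_of_mem ?_ _
    simp only [Finset.mem_filter, Finset.mem_product, Finset.mem_range] at hp
    exact ⟨hp.2, (h _).2 hp.1.2⟩
  · intro p hp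
    refine indicator_of_notMem (fun hmem => hp ?_) _
    have h1 : p.2 < n := (h _).1 hmem.2
    simp only [Finset.mem_filter, Finset.mem_product, Finset.mem_range]
    exact ⟨⟨hmem.1.trans h1, h1⟩, hmem.1⟩

lemma interClaimTime_ne_top_of_le {Ω : Type*} {T : ℕ → Ω → ℝ≥0∞} {i : ℕ} {ω : Ω} {t : ℝ≥0}
    (h : T (i + 1) ω ≤ t) : interClaimTime T i ω ≠ ∞ := by
  have h' : T (i + 1) ω ≠ ∞ := (h.trans_lt ENNReal.coe_lt_top).ne
  rw [interClaimTime_of_ne_top h']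
  exact (tsub_le_self.trans_lt h'.lt_top).ne

variable {Ω : Type*} [MeasurableSpace Ω] {P : Measure Ω} {T : ℕ → Ω → ℝ≥0∞} {X : ℕ → Ω → ℝ}
  {L : Measure ℝ≥0}

lemma IsClaimArrivalSequence.ae_interClaimTime_pair_ne_top (hT : IsClaimArrivalSequence P T)
    (t : ℝ≥0) : ∀ᵐ ω ∂P, ∀ i j, i ≤ j → T (j + 1) ω ≤ t →
      interClaimTime T i ω ≠ ∞ ∧ interClaimTime T j ω ≠ ∞ := by
  filter_upwards [hT.ae_monotone] with ω hm i j hij hj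
  exact ⟨interClaimTime_ne_top_of_le ((hm (Nat.succ_le_succ hij)).trans hj),
    interClaimTime_ne_top_of_le hj⟩

/-- All terms are nonnegative, so expectation and sums commute freely. Each term is replaced by its
conditional mean before Campbell's formula is applied. -/
lemma lintegral_aggregateClaim_sq [IsFiniteMeasure P]
    (hT : IsClaimArrivalSequence P T) (hN : IsMixedPoissonProcess P (claimNumber T) L)
    (hX : ∀ i, Measurable (X i)) (hdep : DependOnlyOnInterClaimTimes P T X)
    (hind : CondIndepGivenArrivals P T X) (hmom : SameCondMoments P T X)
    (h0 : ∀ i, 0 ≤ᵐ[P] X i) (t : ℝ≥0) :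
    ∫⁻ ω, ENNReal.ofReal (aggregateClaim T X t ω ^ 2) ∂P =
      (∫⁻ r : ℝ≥0, (∫⁻ v : ℝ in Ioc 0 (t : ℝ), ENNReal.ofReal
        (singleIntegrand (condMoment P 2 (X 0) (interClaimTime T 0)) t r v)) ∂L) +
      ∫⁻ r : ℝ≥0, (∫⁻ y : ℝ in Ioc 0 (t : ℝ), ∫⁻ v : ℝ in Ioc 0 (t - y), ENNReal.ofReal
        (pairIntegrand (condMoment P 1 (X 0) (interClaimTime T 0)) t r y v)) ∂L := by
  have hmT := hT.measurable
  set Δ := condMoment P 1 (X 0) (interClaimTime T 0) with hΔ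
  set Θ := condMoment P 2 (X 0) (interClaimTime T 0) with hΘ
  have hmΔ : Measurable Δ := measurable_condMoment _ _ _
  have hmΘ : Measurable Θ := measurable_condMoment _ _ _
  have hD : ∀ i, MeasurableSet {ω | T (i + 1) ω ≤ t} :=
    fun i => measurableSet_le (hmT _) measurable_const
  have hD2 : ∀ p : ℕ × ℕ, MeasurableSet {ω | p.1 < p.2 ∧ T (p.2 + 1) ω ≤ t} :=
    fun p => (MeasurableSet.const _).inter (hD p.2)
  have hexp : (fun ω => ENNReal.ofReal (aggregateClaim T X t ω ^ 2)) =ᵐ[P] fun ω =>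
      ∑' i, {ω | T (i + 1) ω ≤ t}.indicator (fun ω => ENNReal.ofReal (X i ω ^ 2)) ω +
      ∑' p : ℕ × ℕ, {ω | p.1 < p.2 ∧ T (p.2 + 1) ω ≤ t}.indicator
        (fun ω => ENNReal.ofReal (2 * (X p.1 ω * X p.2 ω))) ω := by
    filter_upwards [hT.ae_le_iff, ae_all_iff.2 h0] with ω h h0
    have h2 : ∀ p : ℕ × ℕ, 0 ≤ 2 * (X p.1 ω * X p.2 ω) :=
      fun p => mul_nonneg zero_le_two (mul_nonneg (h0 _) (h0 _))
    rw [tsum_indicator_arrival (h t), tsum_indicator_arrival_pair (h t), aggregateClaim,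
      sq_sum_range, ENNReal.ofReal_add (Finset.sum_nonneg fun i _ => sq_nonneg _)
      (Finset.sum_nonneg fun p _ => h2 p), ENNReal.ofReal_sum_of_nonneg fun i _ => sq_nonneg _,
      ENNReal.ofReal_sum_of_nonneg fun p _ => h2 p]
  have hm1 : ∀ i, Measurable
      ({ω | T (i + 1) ω ≤ t}.indicator fun ω => ENNReal.ofReal (X i ω ^ 2)) :=
    fun i => ((hX i).pow_const 2).ennreal_ofReal.indicator (hD i)
  have hm2 : ∀ p : ℕ × ℕ, Measurable ({ω | p.1 < p.2 ∧ T (p.2 + 1) ω ≤ t}.indicator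
      fun ω => ENNReal.ofReal (2 * (X p.1 ω * X p.2 ω))) :=
    fun p => (((hX p.1).mul (hX p.2)).const_mul 2).ennreal_ofReal.indicator (hD2 p)
  rw [lintegral_congr_ae hexp, lintegral_add_left (Measurable.tsum hm1),
    lintegral_tsum fun i => (hm1 i).aemeasurable, lintegral_tsum fun p => (hm2 p).aemeasurable]
  congr 1
  · trans ∑' i, ∫⁻ ω in {ω | T (i + 1) ω ≤ t}, ENNReal.ofReal (Θ (interClaimTime T i ω)) ∂P
    · refine tsum_congr fun i => ?_
      rw [lintegral_indicator (hD i)]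
      exact setLIntegral_claim_sq hmT hX hdep hind hmom i
        (B := {τ | τ (i + 1) ≤ t}) (measurableSet_le (measurable_pi_apply _) measurable_const)
        (ae_of_all _ fun ω hω => interClaimTime_ne_top_of_le hω)
    · rw [hT.tsum_lintegral_single hN t hmΘ]
      refine lintegral_congr fun r => lintegral_congr fun v => ?_
      rw [singleIntegrand]
      ring_nf
  · trans ∑' p : ℕ × ℕ, ∫⁻ ω in {ω | p.1 < p.2 ∧ T (p.2 + 1) ω ≤ t},
      ENNReal.ofReal (2 * (Δ (interClaimTime T p.1 ω) * Δ (interClaimTime T p.2 ω))) ∂P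
    · refine tsum_congr fun p => ?_
      rw [lintegral_indicator (hD2 p)]
      by_cases hp : p.1 < p.2
      · refine setLIntegral_claim_mul_claim_of_nonneg hmT hX hdep hind hmom h0 hp.ne
          (B := {τ | p.1 < p.2 ∧ τ (p.2 + 1) ≤ t}) ((MeasurableSet.const _).inter
            (measurableSet_le (measurable_pi_apply _) measurable_const)) ?_
        filter_upwards [hT.ae_interClaimTime_pair_ne_top t] with ω h hω
        exact h _ _ hp.le hω.2
      · simp [hp]
    · rw [hT.tsum_lintegral_pair hN t (h := fun y v => Δ y * Δ v) (by fun_prop)]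
      simp_rw [pairIntegrand_eq]

/-- `G1 + G2` below is the candidate for the conditional second moment given the arrivals.
Campbell's formula shows that it is integrable with the required integral. Comparison with `S(t)^2`
is then made one value of `N(t)` at a time. -/
lemma integral_aggregateClaim_sq [IsFiniteMeasure P] [SFinite L]
    (hT : IsClaimArrivalSequence P T) (hN : IsMixedPoissonProcess P (claimNumber T) L)
    (hX : ∀ i, Measurable (X i)) (hdep : DependOnlyOnInterClaimTimes P T X)
    (hind : CondIndepGivenArrivals P T X) (hmom : SameCondMoments P T X) (t : ℝ≥0)
    {Δ Θ : ℝ≥0∞ → ℝ} (hΔ : Δ = condMoment P 1 (X 0) (interClaimTime T 0))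
    (hΘ : Θ = condMoment P 2 (X 0) (interClaimTime T 0))
    (h1 : (∫⁻ r : ℝ≥0, (∫⁻ v : ℝ in Ioc 0 (t : ℝ),
      ENNReal.ofReal |singleIntegrand Θ t r v|) ∂L) ≠ ∞)
    (h2 : (∫⁻ r : ℝ≥0, (∫⁻ y : ℝ in Ioc 0 (t : ℝ), ∫⁻ v : ℝ in Ioc 0 (t - y),
      ENNReal.ofReal |pairIntegrand Δ t r y v|) ∂L) ≠ ∞) :
    Integrable (fun ω => aggregateClaim T X t ω ^ 2) P ∧
      ∫ ω, aggregateClaim T X t ω ^ 2 ∂P =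
        (∫ r : ℝ≥0, (∫ v in (0 : ℝ)..t, singleIntegrand Θ t r v) ∂L) +
        ∫ r : ℝ≥0, (∫ y in (0 : ℝ)..t, ∫ v in (0 : ℝ)..(t - y), pairIntegrand Δ t r y v) ∂L := by
  have hmT := hT.measurable
  have hV := measurable_interClaimTime hmT
  have hmΔ : Measurable Δ := hΔ ▸ measurable_condMoment _ _ _
  have hmΘ : Measurable Θ := hΘ ▸ measurable_condMoment _ _ _
  have hD : ∀ i, MeasurableSet {ω | T (i + 1) ω ≤ t} :=
    fun i => measurableSet_le (hmT _) measurable_const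
  have hD2 : ∀ p : ℕ × ℕ, MeasurableSet {ω | p.1 < p.2 ∧ T (p.2 + 1) ω ≤ t} :=
    fun p => (MeasurableSet.const _).inter (hD p.2)
  have hmf : ∀ i, Measurable fun ω => Θ (interClaimTime T i ω) := fun i => hmΘ.comp (hV i)
  have hmg : ∀ p : ℕ × ℕ, Measurable fun ω =>
      2 * (Δ (interClaimTime T p.1 ω) * Δ (interClaimTime T p.2 ω)) :=
    fun p => ((hmΔ.comp (hV p.1)).mul (hmΔ.comp (hV p.2))).const_mul 2
  -- the conditional second moment of the aggregate claim
  let G1 : Ω → ℝ := fun ω =>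
    ∑' i, {ω | T (i + 1) ω ≤ t}.indicator (fun ω => Θ (interClaimTime T i ω)) ω
  let G2 : Ω → ℝ := fun ω => ∑' p : ℕ × ℕ, {ω | p.1 < p.2 ∧ T (p.2 + 1) ω ≤ t}.indicator
    (fun ω => 2 * (Δ (interClaimTime T p.1 ω) * Δ (interClaimTime T p.2 ω))) ω
  have hs1 : ∀ r : ℝ≥0, ∀ v ∈ Ioc (0 : ℝ) t, 0 ≤ (r : ℝ) * Real.exp (-(r * v)) * (r * (t - v) + 1) :=
    fun r v hv => mul_nonneg (mul_nonneg r.coe_nonneg (Real.exp_nonneg _))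
      (add_nonneg (mul_nonneg r.coe_nonneg (sub_nonneg.2 hv.2)) zero_le_one)
  have hsingle : ∀ r v, singleIntegrand Θ t r v =
      r * Real.exp (-(r * v)) * (r * (t - v) + 1) * Θ (ENNReal.ofReal v) := by
    intro r v
    rw [singleIntegrand]
    ring
  have e1 : ∑' i, ∫⁻ ω in {ω | T (i + 1) ω ≤ t}, ENNReal.ofReal |Θ (interClaimTime T i ω)| ∂P =
      ∫⁻ r : ℝ≥0, (∫⁻ v : ℝ in Ioc 0 (t : ℝ), ENNReal.ofReal |singleIntegrand Θ t r v|) ∂L := by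
    rw [hT.tsum_lintegral_single hN t (θ := fun v => |Θ v|) hmΘ.abs]
    refine lintegral_congr fun r => setLIntegral_congr_fun measurableSet_Ioc fun v hv => ?_
    rw [hsingle, abs_mul _ (Θ _), abs_of_nonneg (hs1 r v hv)]
  have e2 : ∑' p : ℕ × ℕ, ∫⁻ ω in {ω | p.1 < p.2 ∧ T (p.2 + 1) ω ≤ t}, ENNReal.ofReal
      |2 * (Δ (interClaimTime T p.1 ω) * Δ (interClaimTime T p.2 ω))| ∂P =
      ∫⁻ r : ℝ≥0, (∫⁻ y : ℝ in Ioc 0 (t : ℝ), ∫⁻ v : ℝ in Ioc 0 (t - y),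
        ENNReal.ofReal |pairIntegrand Δ t r y v|) ∂L := by
    simp_rw [abs_mul (2 : ℝ), abs_of_pos (zero_lt_two (α := ℝ))]
    rw [hT.tsum_lintegral_pair hN t (h := fun y v => |Δ y * Δ v|)
      ((hmΔ.comp measurable_fst).mul (hmΔ.comp measurable_snd)).abs]
    refine lintegral_congr fun r => lintegral_congr fun y =>
      setLIntegral_congr_fun measurableSet_Ioc fun v hv => ?_
    rw [pairIntegrand_eq, abs_mul (pairWeight _ _ _ _), abs_of_nonneg (pairWeight_nonneg r hv.2)]
  rw [← e1] at h1
  rw [← e2] at h2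
  obtain ⟨hG1, hG1'⟩ := integrable_of_eq_tsum_indicator (F := G1) hD hmf h1 (ae_of_all _ fun _ => rfl)
  obtain ⟨hG2, hG2'⟩ := integrable_of_eq_tsum_indicator (F := G2) hD2 hmg h2 (ae_of_all _ fun _ => rfl)
  rw [hT.tsum_lintegral_single hN t hmΘ,
    hT.tsum_lintegral_single hN t (θ := fun v => -Θ v) hmΘ.neg] at hG1'
  simp_rw [← mul_neg] at hG2'
  rw [hT.tsum_lintegral_pair hN t (h := fun y v => Δ y * Δ v) (by fun_prop),
    -- The sign sits on the second factor to match the form left by `mul_neg`.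
    hT.tsum_lintegral_pair hN t (h := fun y v => Δ y * -Δ v) (by fun_prop)] at hG2'
  rw [e1] at h1
  rw [e2] at h2
  have r1 := iterated_integral_eq_sub (measurable_singleIntegrand hmΘ t) t.coe_nonneg h1
  have r2 := iterated_integral_pair_eq_sub (measurable_pairIntegrand hmΔ t) t.coe_nonneg h2
  rw [← e1] at h1
  rw [← e2] at h2
  simp only [hsingle, ← mul_neg] at r1 hG1'
  simp only [pairIntegrand_eq, ← mul_neg] at r2 hG2'
  simp only [hsingle, pairIntegrand_eq, ← mul_neg]
  -- From here on the right-hand side is the integral of `G1 + G2`.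
  rw [r1, r2, ← hG1', ← hG2', ← integral_add hG1 hG2]
  -- reduction to a fixed number of claims
  let B : ℕ → Set (ℕ → ℝ≥0∞) := fun n => {τ | τ n ≤ t ∧ ¬ τ (n + 1) ≤ t}
  have hB : ∀ n, MeasurableSet (B n) := fun n =>
    (measurableSet_le (measurable_pi_apply _) measurable_const).inter
      (measurableSet_le (measurable_pi_apply _) measurable_const).compl
  have hE : ∀ n, MeasurableSet (arrivalPath T ⁻¹' B n) :=
    fun n => measurable_arrivalPath hmT (hB n)
  have hmem : ∀ᵐ ω ∂P, ∀ n, ω ∈ arrivalPath T ⁻¹' B n ↔ claimNumber T t ω = n := by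
    filter_upwards [hT.ae_le_iff] with ω h n
    change (T n ω ≤ t ∧ ¬ T (n + 1) ω ≤ t) ↔ _
    rw [h, h]
    omega
  have hiT : ∀ n, ∀ i ∈ Finset.range n, ∀ᵐ ω ∂P, ω ∈ arrivalPath T ⁻¹' B n → T (i + 1) ω ≤ t := by
    intro n i hi
    filter_upwards [hmem, hT.ae_le_iff] with ω h h' hω
    rw [h', (h n).1 hω]
    exact Finset.mem_range.1 hi
  have hiV : ∀ n, ∀ i ∈ Finset.range n, ∀ᵐ ω ∂P, arrivalPath T ω ∈ B n →
      interClaimTime T i ω ≠ ∞ := fun n i hi =>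
    (hiT n i hi).mono fun ω h hω => interClaimTime_ne_top_of_le (h hω)
  have hfin1 : ∀ n, ∀ i ∈ Finset.range n, ∫⁻ ω in arrivalPath T ⁻¹' B n,
      ENNReal.ofReal |Θ (interClaimTime T i ω)| ∂P ≠ ∞ := by
    intro n i hi
    refine ne_top_of_le_ne_top (ENNReal.ne_top_of_tsum_ne_top h1 i) ?_
    exact lintegral_mono' (Measure.restrict_mono_ae (hiT n i hi)) le_rfl
  have hfin2 : ∀ n, ∀ p ∈ (Finset.range n ×ˢ Finset.range n).filter (fun p => p.1 < p.2),
      ∫⁻ ω in arrivalPath T ⁻¹' B n, ENNReal.ofReal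
        |2 * (Δ (interClaimTime T p.1 ω) * Δ (interClaimTime T p.2 ω))| ∂P ≠ ∞ := by
    intro n p hp
    simp only [Finset.mem_filter, Finset.mem_product] at hp
    refine ne_top_of_le_ne_top (ENNReal.ne_top_of_tsum_ne_top h2 p) ?_
    exact lintegral_mono' (Measure.restrict_mono_ae
      ((hiT n p.2 hp.1.2).mono fun ω h hω => ⟨hp.2, h hω⟩)) le_rfl
  have hiX : ∀ n, ∀ i ∈ Finset.range n,
      IntegrableOn (fun ω => X i ω ^ 2) (arrivalPath T ⁻¹' B n) P := by
    intro n i hi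
    refine integrableOn_claim_sq hmT hX hdep hind hmom i (hB n) (hiV n i hi) ?_
    rw [← hΘ]
    exact ne_top_of_le_ne_top (hfin1 n i hi)
      (lintegral_mono fun ω => ENNReal.ofReal_le_ofReal (le_abs_self _))
  have hiXX : ∀ n, ∀ i ∈ Finset.range n, ∀ j ∈ Finset.range n,
      IntegrableOn (fun ω => X i ω * X j ω) (arrivalPath T ⁻¹' B n) P := by
    intro n i hi j hj
    -- Cauchy–Schwarz: square integrability on `{N(t) = n}`, which comes from `Θ` alone, makes the
    -- products integrable there.
    exact ((memLp_two_iff_integrable_sq (hX i).aestronglyMeasurable).2 (hiX n i hi)).integrable_mul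
      ((memLp_two_iff_integrable_sq (hX j).aestronglyMeasurable).2 (hiX n j hj))
  have hSn : ∀ n, (fun ω => aggregateClaim T X t ω ^ 2) =ᵐ[P.restrict (arrivalPath T ⁻¹' B n)]
      fun ω => ∑ i ∈ Finset.range n, X i ω ^ 2 +
        ∑ p ∈ (Finset.range n ×ˢ Finset.range n).filter (fun p => p.1 < p.2),
          2 * (X p.1 ω * X p.2 ω) := by
    intro n
    refine (ae_restrict_iff' (hE n)).2 ?_
    filter_upwards [hmem] with ω h hω
    rw [aggregateClaim, (h n).1 hω, sq_sum_range]
  have hGn : ∀ n, (fun ω => G1 ω + G2 ω) =ᵐ[P.restrict (arrivalPath T ⁻¹' B n)]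
      fun ω => ∑ i ∈ Finset.range n, Θ (interClaimTime T i ω) +
        ∑ p ∈ (Finset.range n ×ˢ Finset.range n).filter (fun p => p.1 < p.2),
          2 * (Δ (interClaimTime T p.1 ω) * Δ (interClaimTime T p.2 ω)) := by
    intro n
    refine (ae_restrict_iff' (hE n)).2 ?_
    filter_upwards [hmem, hT.ae_le_iff] with ω h h' hω
    simp only [G1, G2]
    rw [tsum_indicator_arrival (h' t), tsum_indicator_arrival_pair (h' t), (h n).1 hω]
  have hX2 : ∀ n, ∀ p ∈ (Finset.range n ×ˢ Finset.range n).filter (fun p => p.1 < p.2),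
      IntegrableOn (fun ω => 2 * (X p.1 ω * X p.2 ω)) (arrivalPath T ⁻¹' B n) P := by
    intro n p hp
    simp only [Finset.mem_filter, Finset.mem_product] at hp
    exact (hiXX n p.1 hp.1.1 p.2 hp.1.2).const_mul 2
  -- The events `{N(t) = n}` partition the space up to null sets.
  refine integrable_of_setIntegral_eq hE ?_ ?_ (fun ω => sq_nonneg _) (hG1.add hG2) ?_ ?_
  · intro m n hmn
    refine measure_eq_zero_iff_ae_notMem.2 ?_
    filter_upwards [hmem] with ω h hω
    exact hmn (((h m).1 hω.1).symm.trans ((h n).1 hω.2))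
  · filter_upwards [hmem] with ω h
    exact mem_iUnion.2 ⟨_, (h _).2 rfl⟩
  · intro n
    refine Integrable.congr ?_ (hSn n).symm
    exact (integrable_finsetSum _ (hiX n)).add (integrable_finsetSum _ (hX2 n))
  · intro n
    rw [integral_congr_ae (hSn n)]
    refine Eq.trans ?_ (integral_congr_ae (hGn n)).symm
    have hi1 : ∀ i ∈ Finset.range n, Integrable (fun ω => Θ (interClaimTime T i ω))
        (P.restrict (arrivalPath T ⁻¹' B n)) := fun i hi =>
      (integral_eq_sub_of_lintegral_abs (hmf i) (hfin1 n i hi)).1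
    have hi2 : ∀ p ∈ (Finset.range n ×ˢ Finset.range n).filter (fun p => p.1 < p.2),
        Integrable (fun ω => 2 * (Δ (interClaimTime T p.1 ω) * Δ (interClaimTime T p.2 ω)))
        (P.restrict (arrivalPath T ⁻¹' B n)) := fun p hp =>
      (integral_eq_sub_of_lintegral_abs (hmg p) (hfin2 n p hp)).1
    rw [integral_add (integrable_finsetSum _ (hiX n)) (integrable_finsetSum _ (hX2 n)),
      integral_add (integrable_finsetSum _ hi1) (integrable_finsetSum _ hi2),
      integral_finsetSum _ (hiX n), integral_finsetSum _ (hX2 n),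
      integral_finsetSum _ hi1, integral_finsetSum _ hi2]
    congr 1
    · refine Finset.sum_congr rfl fun i hi => ?_
      rw [setIntegral_claim_sq hmT hX hdep hind hmom i (hB n) (hiV n i hi), hΘ]
    · refine Finset.sum_congr rfl fun p hp => ?_
      simp only [Finset.mem_filter, Finset.mem_product] at hp
      rw [integral_const_mul, integral_const_mul, setIntegral_claim_mul_claim_eq_moments hmT hX hdep
        hind hmom hp.2.ne (hB n) _ (hiXX n p.1 hp.1.1 p.2 hp.1.2), hΔ]
      filter_upwards [hiV n p.1 hp.1.1, hiV n p.2 hp.1.2] with ω ha hb hω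
      exact ⟨ha hω, hb hω⟩

end AggregateClaims

end

theorem mainTheorem11 {Ω : Type*} [MeasurableSpace Ω] (P : Measure Ω) [IsProbabilityMeasure P]
    (L : Measure ℝ≥0) [IsProbabilityMeasure L]
    (T : ℕ → Ω → ℝ≥0∞) (X : ℕ → Ω → ℝ)
    (hT : AggregateClaims.IsClaimArrivalSequence P T)
    (hN : AggregateClaims.IsMixedPoissonProcess P (AggregateClaims.claimNumber T) L)
    (hX : ∀ i, Measurable (X i))
    (hdep : AggregateClaims.DependOnlyOnInterClaimTimes P T X)
    (hind : AggregateClaims.CondIndepGivenArrivals P T X)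
    (hmom : AggregateClaims.SameCondMoments P T X)
    (Δ Θ : ℝ≥0∞ → ℝ)
    (hΔ : Δ = AggregateClaims.condMoment P 1 (X 0) (AggregateClaims.interClaimTime T 0))
    (hΘ : Θ = AggregateClaims.condMoment P 2 (X 0) (AggregateClaims.interClaimTime T 0))
    (t : ℝ≥0) :
    -- nonnegative claims: the identity holds in `[0, ∞]`
    ((∀ i, 0 ≤ᵐ[P] X i) →
      ∫⁻ ω, ENNReal.ofReal (AggregateClaims.aggregateClaim T X t ω ^ 2) ∂P =
        (∫⁻ r : ℝ≥0, (∫⁻ v : ℝ in Ioc 0 (t : ℝ),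
          ENNReal.ofReal (AggregateClaims.singleIntegrand Θ t r v)) ∂L) +
        ∫⁻ r : ℝ≥0, (∫⁻ y : ℝ in Ioc 0 (t : ℝ), ∫⁻ v : ℝ in Ioc 0 (t - y),
          ENNReal.ofReal (AggregateClaims.pairIntegrand Δ t r y v)) ∂L) ∧
    -- real claims: the identity holds whenever its right-hand side converges absolutely
    ((∫⁻ r : ℝ≥0, (∫⁻ v : ℝ in Ioc 0 (t : ℝ),
        ENNReal.ofReal |AggregateClaims.singleIntegrand Θ t r v|) ∂L) ≠ ∞ →
      (∫⁻ r : ℝ≥0, (∫⁻ y : ℝ in Ioc 0 (t : ℝ), ∫⁻ v : ℝ in Ioc 0 (t - y),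
        ENNReal.ofReal |AggregateClaims.pairIntegrand Δ t r y v|) ∂L) ≠ ∞ →
      Integrable (fun ω => AggregateClaims.aggregateClaim T X t ω ^ 2) P ∧
      ∫ ω, AggregateClaims.aggregateClaim T X t ω ^ 2 ∂P =
        (∫ r : ℝ≥0, (∫ v in (0 : ℝ)..t, AggregateClaims.singleIntegrand Θ t r v) ∂L) +
        ∫ r : ℝ≥0, (∫ y in (0 : ℝ)..t, ∫ v in (0 : ℝ)..(t - y),
          AggregateClaims.pairIntegrand Δ t r y v) ∂L) := by
  refine ⟨fun h0 => ?_, fun h1 h2 => ?_⟩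
  · rw [hΔ, hΘ]
    exact AggregateClaims.lintegral_aggregateClaim_sq hT hN hX hdep hind hmom h0 t
  · exact AggregateClaims.integral_aggregateClaim_sq hT hN hX hdep hind hmom t hΔ hΘ h1 h2
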